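/- Let $T>0$ and let $X=(X_t)_{t\in[0,T]}$, $X_0=0$, be a zero-mean Gaussian process. For a process $Y$ on $[0,T]$ and integers $m\ge 1$, $1\le k\le m-1$, put \[ \Delta^{(2)}_{m,k}Y=Y_{\frac{k+1}{m}T}-2Y_{\frac{k}{m}T}+Y_{\frac{k-1}{m}T},\qquad \Delta^{(2)}_{m,k}\widehat Y=\frac{\Delta^{(2)}_{m,k}Y}{\sqrt{\mathbf E(\Delta^{(2)}_{m,k}Y)^2}}, \] \[ V^{\widehat Y}_{m,T}=\sum_{k=1}^{m-1}\big(\Delta^{(2)}_{m,k}\widehat Y\big)^2,\qquad d^{\widehat Y,m}_{j,k}=\mathbf E\big[\Delta^{(2)}_{m,j}\widehat Y\,\Delta^{(2)}_{m,k}\widehat Y\big] \] (a normalized increment whose denominator vanishes is read as $0$). Assume that there is a constant $C$ with \[ \max_{1\le k\le in-1}\ \sum_{j=1}^{in-1}\big|d^{\widehat X,in}_{j,k}\big|\le C\qquad\text{for all } n\ge 1 \text{ and } i=1,2, \] and that for some $\gamma\in(0,1)$ there is a fractional Brownian motion $B^\gamma=(B^\gamma_t)_{t\in[0,T]}$, possibly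 on another probability space (a zero-mean Gaussian process with $\mathbf E B^\gamma_tB^\gamma_s=\frac12(t^{2\gamma}+s^{2\gamma}-|t-s|^{2\gamma})$), such that for all $i,j\in\{1,2\}$ \[ \frac1n\Big(\operatorname{cov}\big(i^{-1}V^{\widehat X}_{in,T},\,j^{-1}V^{\widehat X}_{jn,T}\big)-\operatorname{cov}\big(i^{-1}V^{\widehat B^\gamma}_{in,T},\,j^{-1}V^{\widehat B^\gamma}_{jn,T}\big)\Big)\longrightarrow 0\qquad(n\to\infty). \] Then \[ \sqrt n\begin{pmatrix} n^{-1}\big(V^{\widehat X}_{n,T}-\mathbf E V^{\widehat X}_{n,T}\big)\\ (2n)^{-1}\big(V^{\widehat X}_{2n,T}-\mathbf E V^{\widehat X}_{2n,T}\big)\end{pmatrix}\ \xrightarrow{\ d\ }\ \mathcal N(0;\Sigma_\gamma),\qquad \Sigma_\gamma=\begin{pmatrix}\Sigma_{11}&\Sigma_{12}\\ \Sigma_{12}&\Sigma_{22}\end{pmatrix}, \] where \[ \Sigma_{11}=2\Big(1+\frac{2}{(4-2^{2\gamma})^2}\sum_{j=1}^\infty\widehat\rho_\gamma^{\,2}(j)\Big),\qquad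 \Sigma_{22}=\tfrac12\Sigma_{11},\qquad \Sigma_{12}=\frac{1}{2^{2\gamma}(4-2^{2\gamma})^2}\sum_{j\in\mathbb Z}\widetilde\rho_\gamma^{\,2}(j), \] \[ \widehat\rho_\gamma(j)=\tfrac12\big[-6|j|^{2\gamma}-|j-2|^{2\gamma}-|j+2|^{2\gamma}+4|j-1|^{2\gamma}+4|j+1|^{2\gamma}\big], \] \[ \widetilde\rho_\gamma(j)=\tfrac12\big[|j+1|^{2\gamma}+2|j+2|^{2\gamma}-|j+3|^{2\gamma}+|j-1|^{2\gamma}-4|j|^{2\gamma}-|j-3|^{2\gamma}+2|j-2|^{2\gamma}\big]; \] both series converge and $\Sigma_\gamma$ is positive semidefinite. -/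

import Mathlib

open MeasureTheory ProbabilityTheory Filter Topology

noncomputable section

namespace QuadVar

/-- The process `(X_t)_{t ∈ [0,T]}` is a zero-mean Gaussian process on `(Ω, P)`. Processes are
written as functions of a real time; only the times in `[0,T]` matter. -/
structure IsCenteredGaussianOn {Ω : Type*} [MeasurableSpace Ω] (P : Measure Ω) (T : ℝ)
    (X : ℝ → Ω → ℝ) : Prop where
  gaussian : IsGaussianProcess (fun t : Set.Icc (0 : ℝ) T => X t) P
  mean_zero : ∀ t ∈ Set.Icc (0 : ℝ) T, ∫ ω, X t ω ∂P = 0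

/-- `(B_t)_{t ∈ [0,T]}` is a fractional Brownian motion with Hurst index `γ ∈ (0,1)`: the zero-mean
Gaussian process with covariance `E[B_t B_s] = (t^{2γ} + s^{2γ} - |t-s|^{2γ}) / 2`. -/
structure IsFractionalBrownianMotion {Ω : Type*} [MeasurableSpace Ω] (P : Measure Ω) (T γ : ℝ)
    (B : ℝ → Ω → ℝ) : Prop where
  hurst_pos : 0 < γ
  hurst_lt_one : γ < 1
  centeredGaussian : IsCenteredGaussianOn P T B
  covariance_eq : ∀ t ∈ Set.Icc (0 : ℝ) T, ∀ s ∈ Set.Icc (0 : ℝ) T,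
    ∫ ω, B t ω * B s ω ∂P = (1 / 2) * (t ^ (2 * γ) + s ^ (2 * γ) - |t - s| ^ (2 * γ))

/-- Second-order increment at mesh `m`, for `1 ≤ k ≤ m - 1`:
`X_{(k+1)T/m} - 2 X_{kT/m} + X_{(k-1)T/m}`. -/
def secondIncr {Ω : Type*} (T : ℝ) (X : ℝ → Ω → ℝ) (m k : ℕ) (ω : Ω) : ℝ :=
  X (((k : ℝ) + 1) / m * T) ω - 2 * X ((k : ℝ) / m * T) ω + X (((k : ℝ) - 1) / m * T) ω

/-- The second-order increment divided by its standard deviation (the increments are centred). -/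
def normIncr {Ω : Type*} [MeasurableSpace Ω] (P : Measure Ω) (T : ℝ) (X : ℝ → Ω → ℝ)
    (m k : ℕ) (ω : Ω) : ℝ :=
  secondIncr T X m k ω / Real.sqrt (∫ ω', (secondIncr T X m k ω') ^ 2 ∂P)

/-- Normalized second-order quadratic variation at mesh `m`. -/
def quadVar {Ω : Type*} [MeasurableSpace Ω] (P : Measure Ω) (T : ℝ) (X : ℝ → Ω → ℝ)
    (m : ℕ) (ω : Ω) : ℝ :=
  ∑ k ∈ Finset.Icc 1 (m - 1), (normIncr P T X m k ω) ^ 2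

/-- `d_{j,k}`: the covariance of the `j`-th and `k`-th normalized increments at mesh `m`. -/
def incrCov {Ω : Type*} [MeasurableSpace Ω] (P : Measure Ω) (T : ℝ) (X : ℝ → Ω → ℝ)
    (m j k : ℕ) : ℝ :=
  ∫ ω, normIncr P T X m j ω * normIncr P T X m k ω ∂P

def rhoHat (γ : ℝ) (j : ℤ) : ℝ :=
  (1 / 2) * (-6 * |(j : ℝ)| ^ (2 * γ) - |(j : ℝ) - 2| ^ (2 * γ) - |(j : ℝ) + 2| ^ (2 * γ)
    + 4 * |(j : ℝ) - 1| ^ (2 * γ) + 4 * |(j : ℝ) + 1| ^ (2 * γ))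

def rhoTilde (γ : ℝ) (j : ℤ) : ℝ :=
  (1 / 2) * (|(j : ℝ) + 1| ^ (2 * γ) + 2 * |(j : ℝ) + 2| ^ (2 * γ) - |(j : ℝ) + 3| ^ (2 * γ)
    + |(j : ℝ) - 1| ^ (2 * γ) - 4 * |(j : ℝ)| ^ (2 * γ)
    - |(j : ℝ) - 3| ^ (2 * γ) + 2 * |(j : ℝ) - 2| ^ (2 * γ))

/-- `Σ₁₁ = 2 (1 + 2 (4 - 2^{2γ})⁻² ∑_{j ≥ 1} ρ̂_γ(j)²)`. -/
def sigma11 (γ : ℝ) : ℝ :=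
  2 * (1 + 2 / (4 - (2 : ℝ) ^ (2 * γ)) ^ 2 * ∑' j : ℕ, (rhoHat γ ((j : ℤ) + 1)) ^ 2)

/-- `Σ₁₂ = 2^{-2γ} (4 - 2^{2γ})⁻² ∑_{j ∈ ℤ} ρ̃_γ(j)²`. -/
def sigma12 (γ : ℝ) : ℝ :=
  1 / ((2 : ℝ) ^ (2 * γ) * (4 - (2 : ℝ) ^ (2 * γ)) ^ 2) * ∑' j : ℤ, (rhoTilde γ j) ^ 2

/-- The limiting covariance matrix of fractional Brownian motion. -/
def sigmaFBM (γ : ℝ) : Matrix (Fin 2) (Fin 2) ℝ :=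
  !![sigma11 γ, sigma12 γ; sigma12 γ, (1 / 2) * sigma11 γ]

/-- `√n (n⁻¹ (V_n - E V_n), (2n)⁻¹ (V_{2n} - E V_{2n}))`. -/
def centredPair {Ω : Type*} [MeasurableSpace Ω] (P : Measure Ω) (T : ℝ) (X : ℝ → Ω → ℝ)
    (n : ℕ) (ω : Ω) : EuclideanSpace ℝ (Fin 2) :=
  Real.sqrt n • !₂[(n : ℝ)⁻¹ * (quadVar P T X n ω - ∫ ω', quadVar P T X n ω' ∂P),
    (2 * (n : ℝ))⁻¹ * (quadVar P T X (2 * n) ω - ∫ ω', quadVar P T X (2 * n) ω' ∂P)]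

end QuadVar

end

namespace QuadVar

open scoped RealInnerProductSpace

/-! By the Cramér–Wold principle, in the form of characteristic functions, it suffices to study each
combination of the two variations. Stacking the increments of meshes `n` and `2n` into one centred
Gaussian vector `Z`, the combination is a diagonal quadratic form `∑ w_i Z_i²` with weights of order
`n^{-1/2}`. Writing `Z` as a self-adjoint image of a standard Gaussian vector and diagonalizing
(`exists_map_sum_sq_eq`) turns it, in law, into `∑ l_i ξ_i²` with independent standard normal `ξ_i`.
The row-sum hypothesis bounds the covariance operator by the Schur test, so `max |l_i|` tends to
zero.

For small `u` the characteristic function of `ξ² - 1` at `u` is `exp(-u²) + o(u²)`. Multiplying over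
`i` gives a Gaussian characteristic function with error at most `ε ∑ l_i²`, and `∑ l_i²` is half the
variance of the form (`norm_integral_exp_quadraticForm_sub_le`). Hence only convergence of the
variances remains.

By hypothesis these have the same limits as for fractional Brownian motion. There the Wick formula
expresses each covariance through squared correlations, which depend only on the lattice difference
`pj - k`. Their averages converge to series in `ρ̂²` and `ρ̃²`, which are summable because `ρ̂` is a
fourth difference of a power function. The limit matrix is positive semidefinite as a limit of
covariance forms. -/

/-! ### Gaussian fourth moments and the Wick formula. -/

lemma integral_pow_four_gaussianReal (v : NNReal) :
    ∫ x, x ^ 4 ∂gaussianReal 0 v = 3 * (v : ℝ) ^ 2 := by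
  have h := iteratedDeriv_mgf_zero (X := fun x : ℝ ↦ x) (μ := gaussianReal 0 v) (by
    have : integrableExpSet (fun x : ℝ ↦ x) (gaussianReal 0 v) = Set.univ :=
      integrableExpSet_id_gaussianReal
    simp [this]) 4
  -- Differentiating a polynomial times `exp(v t²/2)` replaces `p` by `p' + v t p`; four such steps
  -- from `p = 1`, evaluated at zero, give the moment.
  have h1 (p p' q : ℝ → ℝ) (hp : ∀ t, HasDerivAt p (p' t) t)
      (hq : ∀ t, p' t + v * t * p t = q t) :
      deriv (fun t ↦ p t * Real.exp (v * t ^ 2 / 2)) =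
        fun t ↦ q t * Real.exp (v * t ^ 2 / 2) := by
    ext t
    have he : HasDerivAt (fun t : ℝ ↦ (v : ℝ) * t ^ 2 / 2) (v * t) t :=
      (((hasDerivAt_pow 2 t).const_mul (v : ℝ)).div_const 2).congr_deriv (by norm_num; ring)
    rw [((hp t).fun_mul he.exp).deriv, ← hq]
    ring
  rw [mgf_fun_id_gaussianReal] at h
  have h2 : (fun t : ℝ ↦ Real.exp (0 * t + v * t ^ 2 / 2)) =
      fun t ↦ 1 * Real.exp (v * t ^ 2 / 2) := by simp
  rw [h2, iteratedDeriv_eq_iterate] at h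
  simp only [Function.iterate_succ, Function.iterate_zero, Function.comp_apply, id] at h
  rw [h1 (fun _ ↦ 1) (fun _ ↦ 0) (fun t ↦ v * t) (fun t ↦ hasDerivAt_const t _)
      (fun t ↦ by ring),
    h1 (fun t ↦ v * t) (fun t ↦ v) (fun t ↦ v + v ^ 2 * t ^ 2) (fun t ↦
      ((hasDerivAt_id t).const_mul (v : ℝ)).congr_deriv (by ring)) (fun t ↦ by ring),
    h1 (fun t ↦ v + v ^ 2 * t ^ 2) (fun t ↦ 2 * v ^ 2 * t)
      (fun t ↦ 3 * v ^ 2 * t + v ^ 3 * t ^ 3) (fun t ↦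
      (((hasDerivAt_pow 2 t).const_mul ((v : ℝ) ^ 2)).const_add (v : ℝ)).congr_deriv
        (by norm_num; ring)) (fun t ↦ by ring),
    h1 (fun t ↦ 3 * v ^ 2 * t + v ^ 3 * t ^ 3) (fun t ↦ 3 * v ^ 2 + 3 * v ^ 3 * t ^ 2)
      (fun t ↦ 3 * v ^ 2 + 6 * v ^ 3 * t ^ 2 + v ^ 4 * t ^ 4) (fun t ↦
      (((hasDerivAt_id t).const_mul (3 * (v : ℝ) ^ 2)).add
        ((hasDerivAt_pow 3 t).const_mul ((v : ℝ) ^ 3))).congr_deriv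
        (by norm_num; ring)) (fun t ↦ by ring)] at h
  simpa using h.symm

variable {Ω : Type*} [MeasurableSpace Ω] {P : Measure Ω}

lemma integral_pow_four_of_hasGaussianLaw {U : Ω → ℝ} (hU : HasGaussianLaw U P)
    (h0 : ∫ ω, U ω ∂P = 0) : ∫ ω, U ω ^ 4 ∂P = 3 * (∫ ω, U ω ^ 2 ∂P) ^ 2 := by
  have hm := hU.map_eq_gaussianReal
  have h4 : ∫ ω, U ω ^ 4 ∂P = ∫ x, x ^ 4 ∂(P.map U) :=
    (integral_map hU.aemeasurable (f := fun x : ℝ ↦ x ^ 4) (by fun_prop)).symm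
  rw [h4, hm, h0, integral_pow_four_gaussianReal,
    Real.coe_toNNReal _ (variance_nonneg _ _), variance_of_integral_eq_zero hU.aemeasurable h0]

lemma HasGaussianLaw.integrable_pow {U : Ω → ℝ} (hU : HasGaussianLaw U P) (n : ℕ) :
    Integrable (fun ω ↦ U ω ^ n) P := by
  have := hU.isProbabilityMeasure
  exact (hU.memLp (p := n) (by simp)).integrable_norm_pow' |>.mono'
    (by have := hU.aemeasurable; fun_prop) (by simp)

lemma HasGaussianLaw.memLp_sq {U : Ω → ℝ} (hU : HasGaussianLaw U P) :
    MemLp (fun ω ↦ U ω ^ 2) 2 P := by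
  refine (memLp_two_iff_integrable_sq (by have := hU.aemeasurable; fun_prop)).2 ?_
  simpa [← pow_mul] using HasGaussianLaw.integrable_pow hU 4

/-- The Wick formula `cov(U², W²) = 2 (E[U W])²` for a centred Gaussian pair. -/
lemma covariance_sq_sq {U W : Ω → ℝ} (h : HasGaussianLaw (fun ω ↦ (U ω, W ω)) P)
    (hU0 : ∫ ω, U ω ∂P = 0) (hW0 : ∫ ω, W ω ∂P = 0) :
    cov[fun ω ↦ U ω ^ 2, fun ω ↦ W ω ^ 2; P] = 2 * (∫ ω, U ω * W ω ∂P) ^ 2 := by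
  have := h.isProbabilityMeasure
  have hU := h.fst
  have hW := h.snd
  have iU := hU.integrable
  have iW := hW.integrable
  have iU2 := HasGaussianLaw.integrable_pow hU 2
  have iW2 := HasGaussianLaw.integrable_pow hW 2
  have iU4 := HasGaussianLaw.integrable_pow hU 4
  have iW4 := HasGaussianLaw.integrable_pow hW 4
  have iUW : Integrable (fun ω ↦ U ω * W ω) P := hU.memLp_two.integrable_mul hW.memLp_two
  have iUUWW : Integrable (fun ω ↦ U ω ^ 2 * W ω ^ 2) P :=
    (HasGaussianLaw.memLp_sq hU).integrable_mul (HasGaussianLaw.memLp_sq hW)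
  have hp := integral_pow_four_of_hasGaussianLaw h.fun_add
    (by rw [integral_add iU iW, hU0, hW0, add_zero])
  have hm := integral_pow_four_of_hasGaussianLaw h.fun_sub
    (by rw [integral_sub iU iW, hU0, hW0, sub_zero])
  have i1 : Integrable (fun ω ↦ 2 * U ω ^ 4 + 12 * (U ω ^ 2 * W ω ^ 2)) P :=
    (iU4.const_mul 2).add (iUUWW.const_mul 12)
  have i2 : Integrable (fun ω ↦ U ω ^ 2 + 2 * (U ω * W ω)) P := iU2.add (iUW.const_mul 2)
  have i3 : Integrable (fun ω ↦ U ω ^ 2 - 2 * (U ω * W ω)) P := iU2.sub (iUW.const_mul 2)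
  -- Polarization: the mixed moment is recovered from the fourth moments of the Gaussian variables
  -- `U + W` and `U - W`.
  have e4 : ∫ ω, (U ω + W ω) ^ 4 ∂P + ∫ ω, (U ω - W ω) ^ 4 ∂P =
      2 * ∫ ω, U ω ^ 4 ∂P + 12 * ∫ ω, U ω ^ 2 * W ω ^ 2 ∂P + 2 * ∫ ω, W ω ^ 4 ∂P := by
    rw [← integral_add (HasGaussianLaw.integrable_pow h.fun_add 4)
      (HasGaussianLaw.integrable_pow h.fun_sub 4), ← integral_const_mul, ← integral_const_mul,
      ← integral_const_mul, ← integral_add (iU4.const_mul 2) (iUUWW.const_mul 12),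
      ← integral_add i1 (iW4.const_mul 2)]
    congr 1; ext ω; ring
  have ep : ∫ ω, (U ω + W ω) ^ 2 ∂P =
      ∫ ω, U ω ^ 2 ∂P + 2 * ∫ ω, U ω * W ω ∂P + ∫ ω, W ω ^ 2 ∂P := by
    rw [← integral_const_mul, ← integral_add iU2 (iUW.const_mul 2),
      ← integral_add i2 iW2]
    congr 1; ext ω; ring
  have em : ∫ ω, (U ω - W ω) ^ 2 ∂P =
      ∫ ω, U ω ^ 2 ∂P - 2 * ∫ ω, U ω * W ω ∂P + ∫ ω, W ω ^ 2 ∂P := by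
    rw [← integral_const_mul, ← integral_sub iU2 (iUW.const_mul 2),
      ← integral_add i3 iW2]
    congr 1; ext ω; ring
  rw [covariance_eq_sub (HasGaussianLaw.memLp_sq hU) (HasGaussianLaw.memLp_sq hW)]
  simp only [Pi.mul_apply]
  rw [hp, hm, ep, em, integral_pow_four_of_hasGaussianLaw hU hU0,
    integral_pow_four_of_hasGaussianLaw hW hW0] at e4
  linear_combination -e4 / 12

/-! ### The centred chi-square law near frequency zero. -/

/-- Second-order expansion at `0` of the characteristic function of `ξ² - 1`, `ξ` standard normal. -/
lemma exists_norm_integral_exp_sq_sub_one_le {ε : ℝ} (hε : 0 < ε) :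
    ∃ δ > 0, ∀ u : ℝ, |u| ≤ δ →
      ‖∫ x, Complex.exp ((u * (x ^ 2 - 1) : ℝ) * Complex.I) ∂gaussianReal 0 1
        - (Real.exp (-u ^ 2) : ℂ)‖ ≤ ε * u ^ 2 := by
  set μ := gaussianReal 0 1
  have i4 : Integrable (fun x : ℝ ↦ x ^ 4) μ :=
    HasGaussianLaw.integrable_pow (U := id) IsGaussian.hasGaussianLaw_id 4
  have i2 : Integrable (fun x : ℝ ↦ x ^ 2) μ :=
    HasGaussianLaw.integrable_pow (U := id) IsGaussian.hasGaussianLaw_id 2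
  have m2 : ∫ x, x ^ 2 ∂μ = 1 := by
    rw [← variance_of_integral_eq_zero (X := fun x ↦ x) aemeasurable_id' (by simp [μ])]
    simp [μ]
  have m4 : ∫ x, x ^ 4 ∂μ = 3 := by simpa using integral_pow_four_gaussianReal 1
  -- The variance of `ξ² - 1` is `3 - 1 = 2`; dividing by `√2` gives the unit variance that the
  -- Taylor expansion requires.
  set X : ℝ → ℝ := fun x ↦ (x ^ 2 - 1) / √2
  have hX : Measurable X := by fun_prop
  have h0 : μ[X] = 0 := by
    simp only [X]
    rw [integral_div, integral_sub i2 (by fun_prop), m2]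
    simp
  have h1 : μ[X ^ 2] = 1 := by
    have : X ^ 2 = fun x ↦ (x ^ 4 - 2 * x ^ 2 + 1) / 2 := by
      ext x
      simp only [X, Pi.pow_apply, div_pow, Real.sq_sqrt zero_le_two]
      ring
    have i5 : Integrable (fun x : ℝ ↦ x ^ 4 - 2 * x ^ 2) μ := i4.sub (i2.const_mul 2)
    rw [this, integral_div, integral_add i5 (by fun_prop), integral_sub i4 (i2.const_mul 2),
      integral_const_mul, m2, m4]
    simp
    norm_num
  have hT := (taylor_charFun_two hX.aemeasurable h0 h1).def (c := ε / 4) (by positivity)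
  obtain ⟨r, hr, hT⟩ := Metric.eventually_nhds_iff.1 hT
  -- The bound `r / 2` keeps `√2 |u|` below `r`; the other two bound the remainder `u⁴` of
  -- `exp(-u²)` by `(ε / 2) u²`.
  refine ⟨min (r / 2) (min 1 (ε / 2)), by positivity, fun u hu ↦ ?_⟩
  have hu1 : |u| ≤ r / 2 := hu.trans (min_le_left _ _)
  have hu2 : |u| ≤ 1 := hu.trans ((min_le_right _ _).trans (min_le_left _ _))
  have hu3 : |u| ≤ ε / 2 := hu.trans ((min_le_right _ _).trans (min_le_right _ _))
  have h2 : √2 ^ 2 = 2 := Real.sq_sqrt zero_le_two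
  have hs : √2 < 2 := by nlinarith [Real.sqrt_nonneg 2]
  have hT := @hT (√2 * u) (by
    rw [dist_zero_right, Real.norm_eq_abs, abs_mul, abs_of_nonneg (Real.sqrt_nonneg 2)]
    rcases (abs_nonneg u).eq_or_lt with h | h
    · simpa [← h] using hr
    · nlinarith)
  have hc : charFun (μ.map X) (√2 * u) =
      ∫ x, Complex.exp ((u * (x ^ 2 - 1) : ℝ) * Complex.I) ∂μ := by
    rw [charFun_apply_real, integral_map hX.aemeasurable (by fun_prop)]
    congr 1 with x
    congr 2
    rw [← Complex.ofReal_mul]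
    congr 1
    simp only [X]
    field_simp
  rw [hc] at hT
  have he : |Real.exp (-u ^ 2) - (1 - u ^ 2)| ≤ ε / 2 * u ^ 2 := by
    have hu4 : u ^ 2 ≤ 1 := by rw [← sq_abs]; nlinarith [abs_nonneg u]
    have := Real.abs_exp_sub_one_sub_id_le (x := -u ^ 2) (by
      rw [abs_neg, abs_of_nonneg (sq_nonneg u)]; exact hu4)
    rw [show Real.exp (-u ^ 2) - (1 - u ^ 2) = Real.exp (-u ^ 2) - 1 - -u ^ 2 by ring]
    refine this.trans ?_
    have : u ^ 2 ≤ ε / 2 := by rw [← sq_abs]; nlinarith [abs_nonneg u]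
    nlinarith [sq_nonneg u]
  have hn : ‖(√2 * u) ^ 2‖ = 2 * u ^ 2 := by
    rw [mul_pow, h2, Real.norm_eq_abs, abs_of_nonneg (by positivity)]
  rw [hn] at hT
  have he' : ‖((1 - u ^ 2 : ℝ) : ℂ) - (Real.exp (-u ^ 2) : ℂ)‖ ≤ ε / 2 * u ^ 2 := by
    rw [← Complex.ofReal_sub, Complex.norm_real, Real.norm_eq_abs, abs_sub_comm]
    exact he
  have h3 : (1 - ((√2 * u : ℝ) : ℂ) ^ 2 / 2) = ((1 - u ^ 2 : ℝ) : ℂ) := by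
    rw [← Complex.ofReal_pow, mul_pow, h2]; push_cast; ring
  rw [h3] at hT
  calc _ ≤ _ := norm_sub_le_norm_sub_add_norm_sub _ ((1 - u ^ 2 : ℝ) : ℂ) _
    _ ≤ ε / 4 * (2 * u ^ 2) + ε / 2 * u ^ 2 := add_le_add hT he'
    _ = ε * u ^ 2 := by ring

/-! ### Diagonalization of Gaussian quadratic forms. -/

open scoped MatrixOrder in
/-- A centred Gaussian vector is the image of a standard Gaussian vector under a self-adjoint
operator. -/
lemma exists_map_eq_stdGaussian_map {Ω : Type*} [MeasurableSpace Ω] {P : Measure Ω}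
    {ι : Type*} [Fintype ι] {Z : ι → Ω → ℝ} (hZ : HasGaussianLaw (fun ω i ↦ Z i ω) P)
    (h0 : ∀ i, ∫ ω, Z i ω ∂P = 0) :
    ∃ S : EuclideanSpace ℝ ι →L[ℝ] EuclideanSpace ℝ ι, IsSelfAdjoint S ∧
      P.map (fun ω ↦ WithLp.toLp 2 (fun i ↦ Z i ω)) = (stdGaussian (EuclideanSpace ℝ ι)).map S ∧
      ∀ v : EuclideanSpace ℝ ι, ‖S v‖ ^ 2 = ∫ ω, (∑ i, v i * Z i ω) ^ 2 ∂P := by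
  classical
  have := hZ.isProbabilityMeasure
  have hm (i) : MemLp (Z i) 2 P := (hZ.eval i).memLp_two
  set K : Matrix ι ι ℝ := Matrix.of fun i j ↦ cov[Z i, Z j; P] with hKdef
  have hsum (v : ι → ℝ) : ∫ ω, (∑ i, v i * Z i ω) ^ 2 ∂P = Var[fun ω ↦ ∑ i, v i * Z i ω; P] := by
    rw [variance_of_integral_eq_zero]
    · exact (memLp_finsetSum _ fun i _ ↦ (hm i).const_mul (v i)).aemeasurable
    · rw [integral_finsetSum _ fun i _ ↦ ((hm i).integrable one_le_two).const_mul _]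
      simp [integral_const_mul, h0]
  have hquad (v : ι → ℝ) : dotProduct v (K.mulVec v) = ∫ ω, (∑ i, v i * Z i ω) ^ 2 ∂P := by
    rw [hsum, ← covariance_self (memLp_finsetSum _ fun i _ ↦ (hm i).const_mul (v i)).aemeasurable,
      covariance_fun_sum_fun_sum (fun i ↦ (hm i).const_mul (v i)) fun i ↦ (hm i).const_mul (v i)]
    simp only [dotProduct, Matrix.mulVec, Finset.mul_sum, covariance_const_mul_left,
      covariance_const_mul_right, hKdef, Matrix.of_apply]
    exact Finset.sum_congr rfl fun i _ ↦ Finset.sum_congr rfl fun j _ ↦ by ring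
  have hK : K.PosSemidef := by
    refine Matrix.PosSemidef.of_dotProduct_mulVec_nonneg ?_ fun v ↦ ?_
    · ext i j
      simp [hKdef, covariance_comm]
    · rw [star_trivial, hquad]
      positivity
  -- The positive square root of the covariance matrix `K`; then `‖S v‖² = ⟨v, K v⟩`.
  set S := Matrix.toEuclideanCLM (𝕜 := ℝ) (CFC.sqrt K)
  have hS : IsSelfAdjoint S := (CFC.sqrt_nonneg K).isSelfAdjoint.map _
  refine ⟨S, hS, ?_, fun v ↦ ?_⟩
  · have hl : (stdGaussian (EuclideanSpace ℝ ι)).map S = multivariateGaussian 0 K := by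
      simp [multivariateGaussian, S]
    rw [hl]
    have hg := (hZ.toLp_pi 2).isGaussian_map
    have hae := (hZ.toLp_pi 2).aemeasurable
    refine IsGaussian.ext ?_ ?_
    · rw [integral_id_multivariateGaussian', integral_map hae (by fun_prop)]
      ext i
      simp only [id]
      rw [eval_integral_piLp]
      · simp [h0]
      · exact fun i ↦ (hm i).integrable one_le_two
    · rw [← ContinuousLinearMap.toBilinForm_inj]
      refine LinearMap.BilinForm.ext_basis (EuclideanSpace.basisFun ι ℝ).toBasis fun i j ↦ ?_
      rw [ContinuousLinearMap.toBilinForm_apply, ContinuousLinearMap.toBilinForm_apply,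
        covarianceBilin_multivariateGaussian hK, covarianceBilin_apply_eq_cov hg.memLp_two_id,
        covariance_map]
      · simp [Function.comp_def, PiLp.inner_apply, hKdef]
      all_goals first | exact hae | fun_prop
  · rw [← real_inner_self_eq_norm_sq, ← ContinuousLinearMap.adjoint_inner_right, hS.adjoint_eq,
      ← ContinuousLinearMap.comp_apply, ← ContinuousLinearMap.mul_def, ← map_mul,
      CFC.sqrt_mul_sqrt_self _ hK.nonneg, Matrix.inner_toEuclideanCLM, hquad]

/-- A diagonal quadratic form in a centred Gaussian vector has the law of a diagonal quadratic form
in independent standard normal variables. -/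
lemma exists_map_sum_sq_eq {Ω : Type*} [MeasurableSpace Ω] {P : Measure Ω}
    {ι : Type*} [Fintype ι] {Z : ι → Ω → ℝ} (hZ : HasGaussianLaw (fun ω i ↦ Z i ω) P)
    (h0 : ∀ i, ∫ ω, Z i ω ∂P = 0) (w : ι → ℝ) {W M : ℝ} (hW : ∀ i, |w i| ≤ W)
    (hM : ∀ v : ι → ℝ, ∫ ω, (∑ i, v i * Z i ω) ^ 2 ∂P ≤ M * ∑ i, v i ^ 2) :
    ∃ (m : ℕ) (l : Fin m → ℝ), (∀ i, |l i| ≤ W * M) ∧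
      P.map (fun ω ↦ ∑ i, w i * Z i ω ^ 2) =
        (Measure.pi fun _ : Fin m ↦ gaussianReal 0 1).map (fun x ↦ ∑ i, l i * x i ^ 2) := by
  classical
  obtain ⟨S, hS, hmap, hnorm⟩ := exists_map_eq_stdGaussian_map hZ h0
  set D := Matrix.toEuclideanCLM (𝕜 := ℝ) (Matrix.diagonal w)
  have hD (x y : EuclideanSpace ℝ ι) : ⟪x, D y⟫ = ∑ i, w i * (x i * y i) := by
    simp only [D, Matrix.inner_toEuclideanCLM, dotProduct, Matrix.mulVec_diagonal]
    exact Finset.sum_congr rfl fun i _ ↦ by ring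
  -- With `Z = S G` in law, the form is `⟨G, S D S G⟩`. By rotation invariance, `G` has independent
  -- standard coordinates in an eigenbasis of `S D S`.
  set A : EuclideanSpace ℝ ι →ₗ[ℝ] EuclideanSpace ℝ ι := (S * D * S).toLinearMap
  have hA (x y : EuclideanSpace ℝ ι) : ⟪x, A y⟫ = ∑ i, w i * (S x i * S y i) := by
    change ⟪x, S (D (S y))⟫ = _
    rw [← hD, ← ContinuousLinearMap.adjoint_inner_left, hS.adjoint_eq]
  have hsymm : A.IsSymmetric := fun x y ↦ by
    rw [real_inner_comm, hA, hA]
    exact Finset.sum_congr rfl fun i _ ↦ by ring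
  set b := hsymm.eigenvectorBasis rfl
  set l := hsymm.eigenvalues rfl
  have hb (i j) : ⟪b i, A (b j)⟫ = if i = j then l j else 0 := by
    rw [hsymm.apply_eigenvectorBasis, inner_smul_right]
    simp [b, l, orthonormal_iff_ite.1 (hsymm.eigenvectorBasis rfl).orthonormal]
  refine ⟨_, l, fun i ↦ ?_, ?_⟩
  · have h1 : l i = ∑ k, w k * (S (b i) k * S (b i) k) := by rw [← hA, hb, if_pos rfl]
    have h2 : ∑ k, (S (b i) k) ^ 2 ≤ M := by
      rw [← EuclideanSpace.real_norm_sq_eq, hnorm]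
      refine (hM _).trans_eq ?_
      rw [← EuclideanSpace.real_norm_sq_eq, b.norm_eq_one]
      simp
    rw [h1]
    -- Over an empty index set `W` may be negative, but then there is no unit eigenvector to bound.
    have hW0 : 0 ≤ W ∨ IsEmpty ι := by
      rcases isEmpty_or_nonempty ι with h | ⟨⟨k⟩⟩
      · exact .inr h
      · exact .inl ((abs_nonneg _).trans (hW k))
    rcases hW0 with hW0 | hι
    · calc _ ≤ ∑ k, |w k * (S (b i) k * S (b i) k)| := Finset.abs_sum_le_sum_abs _ _
        _ ≤ ∑ k, W * (S (b i) k) ^ 2 := Finset.sum_le_sum fun k _ ↦ by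
          rw [abs_mul, ← sq, abs_of_nonneg (sq_nonneg (S (b i) k))]
          exact mul_le_mul_of_nonneg_right (hW k) (sq_nonneg _)
        _ ≤ W * M := by rw [← Finset.mul_sum]; exact mul_le_mul_of_nonneg_left h2 hW0
    · have : Subsingleton (EuclideanSpace ℝ ι) := inferInstance
      exact absurd (b.norm_eq_one i) (by simp [Subsingleton.elim (b i) 0])
  · have hq : (fun ω ↦ ∑ i, w i * Z i ω ^ 2) =
        (fun x : EuclideanSpace ℝ ι ↦ ∑ i, w i * x i ^ 2) ∘
          fun ω ↦ WithLp.toLp 2 (fun i ↦ Z i ω) := by ext; simp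
    have hmeas : Measurable (fun x : EuclideanSpace ℝ ι ↦ ∑ i, w i * x i ^ 2) := by fun_prop
    rw [hq, ← AEMeasurable.map_map_of_aemeasurable hmeas.aemeasurable
      (hZ.toLp_pi 2).aemeasurable, hmap, stdGaussian_eq_map_pi_orthonormalBasis b,
      Measure.map_map hmeas S.measurable, Measure.map_map (hmeas.comp S.measurable) (by fun_prop)]
    congr 1
    ext x
    have h3 : ∑ i, w i * (S (∑ j, x j • b j) i) ^ 2 = ⟪∑ j, x j • b j, A (∑ j, x j • b j)⟫ := by
      rw [hA]; exact Finset.sum_congr rfl fun i _ ↦ by ring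
    simp only [Function.comp_apply]
    rw [h3]
    simp only [map_sum, map_smul, sum_inner, inner_sum, inner_smul_left, inner_smul_right, hb]
    simp
    exact Finset.sum_congr rfl fun i _ ↦ by ring

/-! ### Central limit theorem for quadratic forms. -/

/-- Factors are exchanged one at a time; all the others lie in the unit disc, so each exchange costs
only its own difference. -/
lemma norm_prod_sub_prod_le {ι : Type*} (s : Finset ι) (f g : ι → ℂ) (hf : ∀ i, ‖f i‖ ≤ 1)
    (hg : ∀ i, ‖g i‖ ≤ 1) : ‖∏ i ∈ s, f i - ∏ i ∈ s, g i‖ ≤ ∑ i ∈ s, ‖f i - g i‖ := by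
  classical
  induction s using Finset.induction with
  | empty => simp
  | insert a s ha ih =>
    rw [Finset.prod_insert ha, Finset.prod_insert ha, Finset.sum_insert ha]
    have hF : ‖∏ i ∈ s, f i‖ ≤ 1 := by
      rw [norm_prod]; exact Finset.prod_le_one (fun _ _ ↦ norm_nonneg _) fun i _ ↦ hf i
    calc ‖f a * ∏ i ∈ s, f i - g a * ∏ i ∈ s, g i‖
        = ‖(f a - g a) * ∏ i ∈ s, f i + g a * (∏ i ∈ s, f i - ∏ i ∈ s, g i)‖ := by
          congr 1; ring
      _ ≤ ‖f a - g a‖ * ‖∏ i ∈ s, f i‖ + ‖g a‖ * ‖∏ i ∈ s, f i - ∏ i ∈ s, g i‖ := by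
          refine (norm_add_le _ _).trans ?_
          rw [norm_mul, norm_mul]
      _ ≤ ‖f a - g a‖ * 1 + 1 * ∑ i ∈ s, ‖f i - g i‖ := by
          gcongr
          exact hg a
      _ = _ := by ring

/-- Quantitative central limit theorem for diagonal quadratic forms in independent standard normal
variables. -/
lemma norm_integral_exp_sum_sq_sub_le {ε δ : ℝ}
    (h : ∀ u : ℝ, |u| ≤ δ →
      ‖∫ x, Complex.exp ((u * (x ^ 2 - 1) : ℝ) * Complex.I) ∂gaussianReal 0 1
        - (Real.exp (-u ^ 2) : ℂ)‖ ≤ ε * u ^ 2)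
    {ι : Type*} [Fintype ι] (l : ι → ℝ) (hl : ∀ i, |l i| ≤ δ) :
    ‖∫ x : ι → ℝ, Complex.exp ((∑ i, l i * (x i ^ 2 - 1) : ℝ) * Complex.I)
        ∂(Measure.pi fun _ ↦ gaussianReal 0 1) - (Real.exp (-∑ i, l i ^ 2) : ℂ)‖
      ≤ ε * ∑ i, l i ^ 2 := by
  have e1 : ∫ x : ι → ℝ, Complex.exp ((∑ i, l i * (x i ^ 2 - 1) : ℝ) * Complex.I)
        ∂(Measure.pi fun _ ↦ gaussianReal 0 1) =
      ∏ i, ∫ x, Complex.exp ((l i * (x ^ 2 - 1) : ℝ) * Complex.I) ∂gaussianReal 0 1 := by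
    rw [← integral_fintype_prod_eq_prod
      (f := fun i (x : ℝ) ↦ Complex.exp ((l i * (x ^ 2 - 1) : ℝ) * Complex.I))]
    congr 1 with x
    rw [← Complex.exp_sum, ← Finset.sum_mul, Complex.ofReal_sum]
  have e2 : (Real.exp (-∑ i, l i ^ 2) : ℂ) = ∏ i, (Real.exp (-l i ^ 2) : ℂ) := by
    rw [← Finset.sum_neg_distrib, Real.exp_sum, Complex.ofReal_prod]
  rw [e1, e2, Finset.mul_sum]
  refine (norm_prod_sub_prod_le _ _ _ (fun i ↦ ?_) fun i ↦ ?_).trans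
    (Finset.sum_le_sum fun i _ ↦ h _ (hl i))
  · refine (norm_integral_le_of_norm_le_const (C := 1)
      (.of_forall fun x ↦ (Complex.norm_exp_ofReal_mul_I _).le)).trans_eq (by simp)
  · rw [Complex.norm_real, Real.norm_eq_abs, abs_of_pos (Real.exp_pos _), Real.exp_le_one_iff]
    simp [sq_nonneg]

lemma integral_sq_gaussianReal : ∫ x, x ^ 2 ∂gaussianReal 0 1 = 1 := by
  rw [← variance_of_integral_eq_zero (X := fun x ↦ x) aemeasurable_id' (by simp)]
  simp

lemma variance_sq_gaussianReal : Var[fun x ↦ x ^ 2; gaussianReal 0 1] = 2 := by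
  have h : HasGaussianLaw (fun x : ℝ ↦ x) (gaussianReal 0 1) := IsGaussian.hasGaussianLaw_id
  have h4 := integral_pow_four_gaussianReal 1
  rw [variance_eq_sub (HasGaussianLaw.memLp_sq h), integral_sq_gaussianReal]
  simp only [Pi.pow_apply, ← pow_mul]
  rw [h4]
  norm_num

/-- Central limit theorem for quadratic forms `Q = ∑ w_i Z_i²` of a centred Gaussian vector whose
weights and covariance operator are bounded by `W` and `M`, with `W * M` small. -/
lemma norm_integral_exp_quadraticForm_sub_le {ε δ : ℝ}
    (h : ∀ u : ℝ, |u| ≤ δ →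
      ‖∫ x, Complex.exp ((u * (x ^ 2 - 1) : ℝ) * Complex.I) ∂gaussianReal 0 1
        - (Real.exp (-u ^ 2) : ℂ)‖ ≤ ε * u ^ 2)
    {Ω : Type*} [MeasurableSpace Ω] {P : Measure Ω}
    {ι : Type*} [Fintype ι] {Z : ι → Ω → ℝ} (hZ : HasGaussianLaw (fun ω i ↦ Z i ω) P)
    (h0 : ∀ i, ∫ ω, Z i ω ∂P = 0) (w : ι → ℝ) {W M : ℝ} (hW : ∀ i, |w i| ≤ W)
    (hM : ∀ v : ι → ℝ, ∫ ω, (∑ i, v i * Z i ω) ^ 2 ∂P ≤ M * ∑ i, v i ^ 2) (hWM : W * M ≤ δ) :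
    ‖∫ ω, Complex.exp ((∑ i, w i * Z i ω ^ 2 - ∫ ω', ∑ i, w i * Z i ω' ^ 2 ∂P : ℝ) * Complex.I) ∂P
        - (Real.exp (-Var[fun ω ↦ ∑ i, w i * Z i ω ^ 2; P] / 2) : ℂ)‖
      ≤ ε * (Var[fun ω ↦ ∑ i, w i * Z i ω ^ 2; P] / 2) := by
  obtain ⟨m, l, hl, hmap⟩ := exists_map_sum_sq_eq hZ h0 w hW hM
  set ν := Measure.pi fun _ : Fin m ↦ gaussianReal 0 1
  have hQ : AEMeasurable (fun ω ↦ ∑ i, w i * Z i ω ^ 2) P := by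
    have := fun i ↦ (hZ.eval i).aemeasurable
    fun_prop
  have hR : Measurable (fun x : Fin m → ℝ ↦ ∑ i, l i * x i ^ 2) := by fun_prop
  have hg : HasGaussianLaw (fun x : ℝ ↦ x) (gaussianReal 0 1) := IsGaussian.hasGaussianLaw_id
  have hmean : ∫ ω, ∑ i, w i * Z i ω ^ 2 ∂P = ∑ i, l i := by
    calc _ = ∫ y, y ∂(P.map fun ω ↦ ∑ i, w i * Z i ω ^ 2) := (integral_map hQ (by fun_prop)).symm
      _ = ∫ x, ∑ i, l i * x i ^ 2 ∂ν := by rw [hmap, integral_map hR.aemeasurable (by fun_prop)]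
      _ = _ := by
        rw [integral_finsetSum]
        · refine Finset.sum_congr rfl fun i _ ↦ ?_
          have := integral_comp_eval (μ := fun _ : Fin m ↦ gaussianReal 0 1) (i := i)
            (f := fun x : ℝ ↦ x ^ 2) (by fun_prop)
          rw [integral_const_mul, this, integral_sq_gaussianReal, mul_one]
        · exact fun i _ ↦ (integrable_comp_eval (μ := fun _ : Fin m ↦ gaussianReal 0 1)
            (f := fun x : ℝ ↦ x ^ 2) (HasGaussianLaw.integrable_pow hg 2)).const_mul _
  -- Each `l ξ²` has variance `2 l²`, which accounts for the halves in the statement.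
  have hvar : Var[fun ω ↦ ∑ i, w i * Z i ω ^ 2; P] / 2 = ∑ i, l i ^ 2 := by
    have e : Var[fun ω ↦ ∑ i, w i * Z i ω ^ 2; P] = Var[fun x ↦ ∑ i, l i * x i ^ 2; ν] := by
      rw [← variance_id_map hQ, hmap, variance_id_map hR.aemeasurable]
    have e2 := variance_sum_pi (μ := fun _ : Fin m ↦ gaussianReal 0 1)
      (X := fun i x ↦ l i * x ^ 2) fun i ↦ (HasGaussianLaw.memLp_sq hg).const_mul (l i)
    rw [e, show (fun x : Fin m → ℝ ↦ ∑ i, l i * x i ^ 2) = ∑ i, fun x ↦ l i * x i ^ 2 by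
      ext; simp, e2, Finset.sum_div]
    refine Finset.sum_congr rfl fun i _ ↦ ?_
    rw [variance_const_mul, variance_sq_gaussianReal]
    ring
  have hch : ∫ ω, Complex.exp
      ((∑ i, w i * Z i ω ^ 2 - ∫ ω', ∑ i, w i * Z i ω' ^ 2 ∂P : ℝ) * Complex.I) ∂P =
      ∫ x, Complex.exp ((∑ i, l i * (x i ^ 2 - 1) : ℝ) * Complex.I) ∂ν := by
    rw [hmean]
    calc _ = ∫ y : ℝ, Complex.exp ((y - ∑ i, l i : ℝ) * Complex.I)
          ∂(P.map fun ω ↦ ∑ i, w i * Z i ω ^ 2) :=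
        (integral_map (f := fun y : ℝ ↦ Complex.exp ((y - ∑ i, l i : ℝ) * Complex.I)) hQ
          (by fun_prop)).symm
      _ = _ := by
        rw [hmap, integral_map hR.aemeasurable (by fun_prop)]
        simp [mul_sub]
  rw [hch, neg_div, hvar]
  exact norm_integral_exp_sum_sq_sub_le h l fun i ↦ (hl i).trans hWM

/-! ### Decay and square-summability of `ρ̂` and `ρ̃`. -/

/-- Mean value theorem for iterated forward differences of a power function. -/
lemma exists_fwdDiff_iter_rpow_eq (n : ℕ) : ∀ (s : ℝ) {x : ℝ}, 0 < x →
    ∃ y ≥ x, (fwdDiff (1 : ℝ))^[n] (fun z ↦ z ^ s) x =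
      (∏ i ∈ Finset.range n, (s - i)) * y ^ (s - n) := by
  -- The induction also carries the derivative: differentiating the `n`-th difference of `z^s` gives
  -- `s` times that of `z^(s-1)`, so the mean value theorem lowers the exponent by one per
  -- difference.
  suffices h : ∀ (s : ℝ) {x : ℝ}, 0 < x →
      (∃ y ≥ x, (fwdDiff (1 : ℝ))^[n] (fun z ↦ z ^ s) x =
        (∏ i ∈ Finset.range n, (s - i)) * y ^ (s - n)) ∧
      HasDerivAt ((fwdDiff (1 : ℝ))^[n] (fun z ↦ z ^ s))
        (s * (fwdDiff (1 : ℝ))^[n] (fun z ↦ z ^ (s - 1)) x) x from fun s x hx ↦ (h s hx).1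
  induction n with
  | zero =>
    intro s x hx
    refine ⟨⟨x, le_rfl, by simp⟩, ?_⟩
    simpa using Real.hasDerivAt_rpow_const (p := s) (.inl hx.ne')
  | succ n ih =>
    intro s x hx
    simp only [Function.iterate_succ', Function.comp_apply]
    constructor
    · obtain ⟨y, hy, hxy⟩ := exists_hasDerivAt_eq_slope
        ((fwdDiff (1 : ℝ))^[n] (fun z ↦ z ^ s))
        (fun x ↦ s * (fwdDiff (1 : ℝ))^[n] (fun z ↦ z ^ (s - 1)) x) (a := x) (b := x + 1)
        (by linarith)
        (fun y hy ↦ (ih s (hx.trans_le hy.1)).2.continuousAt.continuousWithinAt)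
        (fun y hy ↦ (ih s (hx.trans hy.1)).2)
      obtain ⟨z, hz, hyz⟩ := (ih (s - 1) (hx.trans hy.1)).1
      refine ⟨z, hy.1.le.trans hz, ?_⟩
      rw [add_sub_cancel_left, div_one, hyz] at hxy
      rw [fwdDiff, ← hxy, Finset.prod_range_succ']
      have : s - 1 - (n : ℝ) = s - (n + 1 : ℕ) := by push_cast; ring
      rw [this, mul_comm (∏ i ∈ _, _) (s - _), Nat.cast_zero, sub_zero, mul_assoc]
      congr 3
      ext i
      push_cast
      ring
    · have h1 := (ih s (x := x + 1) (by linarith)).2.comp_add_const x 1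
      refine (h1.sub (ih s hx).2).congr_deriv ?_
      rw [fwdDiff, mul_sub]

lemma rhoHat_neg (γ : ℝ) (j : ℤ) : rhoHat γ (-j) = rhoHat γ j := by
  have h (a b : ℝ) (hab : a = -b) : |a| = |b| := by rw [hab, abs_neg]
  simp only [rhoHat, Int.cast_neg]
  rw [h (-(j : ℝ)) j rfl, h (-(j : ℝ) - 2) (j + 2) (by ring), h (-(j : ℝ) + 2) (j - 2) (by ring),
    h (-(j : ℝ) - 1) (j + 1) (by ring), h (-(j : ℝ) + 1) (j - 1) (by ring)]
  ring

/-- A second difference of step two is the `1, 2, 1` combination of unit-step second differences;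
summability of `ρ̃²` thus reduces to that of `ρ̂²`. -/
lemma rhoTilde_eq (γ : ℝ) (j : ℤ) :
    rhoTilde γ j = rhoHat γ (j + 1) + 2 * rhoHat γ j + rhoHat γ (j - 1) := by
  simp only [rhoTilde, rhoHat]
  push_cast
  rw [show (j : ℝ) + 1 - 2 = j - 1 by ring, show (j : ℝ) + 1 + 2 = j + 3 by ring,
    show (j : ℝ) + 1 - 1 = j by ring, show (j : ℝ) + 1 + 1 = j + 2 by ring,
    show (j : ℝ) - 1 - 2 = j - 3 by ring, show (j : ℝ) - 1 + 2 = j + 1 by ring,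
    show (j : ℝ) - 1 - 1 = j - 2 by ring, show (j : ℝ) - 1 + 1 = j by ring]
  ring

/-- The shift by three makes the smallest argument `j + 1` positive, so the absolute values
disappear. -/
lemma rhoHat_eq_fwdDiff (γ : ℝ) (j : ℕ) :
    rhoHat γ ((j : ℤ) + 3) =
      -(1 / 2) * (fwdDiff (1 : ℝ))^[4] (fun z ↦ z ^ (2 * γ)) ((j : ℝ) + 1) := by
  have hj : (0 : ℝ) ≤ j := Nat.cast_nonneg j
  simp only [rhoHat, Function.iterate_succ, Function.iterate_zero, Function.comp_apply, id,
    fwdDiff]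
  push_cast
  rw [abs_of_nonneg (by linarith : (0 : ℝ) ≤ j + 3),
    abs_of_nonneg (by linarith : (0 : ℝ) ≤ j + 3 - 2),
    abs_of_nonneg (by linarith : (0 : ℝ) ≤ j + 3 + 2),
    abs_of_nonneg (by linarith : (0 : ℝ) ≤ j + 3 - 1),
    abs_of_nonneg (by linarith : (0 : ℝ) ≤ j + 3 + 1)]
  ring_nf

/-- The mean value form gives decay of order `j^(2γ-4)`; weakening it to `1/j` already suffices for
square-summability. The constant is half of `2 · 2 · 3 · 4 = 48`. -/
lemma abs_rhoHat_le {γ : ℝ} (h0 : 0 < γ) (h1 : γ < 1) (j : ℕ) :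
    |rhoHat γ ((j : ℤ) + 3)| ≤ 24 * ((j : ℝ) + 1)⁻¹ := by
  have hj : (1 : ℝ) ≤ j + 1 := by have : (0 : ℝ) ≤ j := Nat.cast_nonneg j; linarith
  obtain ⟨y, hy, h⟩ := exists_fwdDiff_iter_rpow_eq 4 (2 * γ) (x := j + 1) (by linarith)
  rw [rhoHat_eq_fwdDiff, h, abs_mul, abs_mul]
  have hy0 : 0 < y := by linarith
  have hp : y ^ (2 * γ - (4 : ℕ)) ≤ ((j : ℝ) + 1)⁻¹ := by
    calc y ^ (2 * γ - (4 : ℕ)) ≤ y ^ (-1 : ℝ) :=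
          Real.rpow_le_rpow_of_exponent_le (by linarith) (by push_cast; linarith)
      _ = y⁻¹ := Real.rpow_neg_one y
      _ ≤ _ := inv_anti₀ (by linarith) hy
  have hc : |∏ i ∈ Finset.range 4, (2 * γ - (i : ℝ))| ≤ 48 := by
    simp only [Finset.prod_range_succ, Finset.prod_range_zero, one_mul, abs_mul]
    push_cast
    have a0 : |2 * γ - 0| ≤ 2 := abs_le.2 ⟨by linarith, by linarith⟩
    have a1 : |2 * γ - 1| ≤ 2 := abs_le.2 ⟨by linarith, by linarith⟩
    have a2 : |2 * γ - 2| ≤ 3 := abs_le.2 ⟨by linarith, by linarith⟩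
    have a3 : |2 * γ - 3| ≤ 4 := abs_le.2 ⟨by linarith, by linarith⟩
    calc _ ≤ (2 : ℝ) * 2 * 3 * 4 := by gcongr
      _ = 48 := by norm_num
  rw [abs_of_nonneg (Real.rpow_nonneg hy0.le _)]
  calc _ ≤ |(-(1 / 2) : ℝ)| * (48 * ((j : ℝ) + 1)⁻¹) := by gcongr
    _ = _ := by norm_num [abs_of_pos]; ring

lemma summable_rhoHat_sq {γ : ℝ} (h0 : 0 < γ) (h1 : γ < 1) :
    Summable (fun j : ℤ ↦ rhoHat γ j ^ 2) := by
  have hs : Summable (fun j : ℕ ↦ rhoHat γ (j : ℤ) ^ 2) := by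
    rw [← summable_nat_add_iff 3]
    have hb : Summable (fun j : ℕ ↦ 576 * (((j : ℝ) + 1) ^ 2)⁻¹) := by
      have := (summable_nat_add_iff 1).2 (Real.summable_nat_pow_inv.2 one_lt_two)
      simpa using this.mul_left 576
    refine hb.of_nonneg_of_le (fun j ↦ sq_nonneg _) fun j ↦ ?_
    have := abs_rhoHat_le h0 h1 j
    push_cast
    rw [← sq_abs]
    calc _ ≤ (24 * ((j : ℝ) + 1)⁻¹) ^ 2 := by gcongr
      _ = _ := by rw [mul_pow, inv_pow]; norm_num
  exact Summable.of_nat_of_neg hs (by simpa [rhoHat_neg] using hs)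

lemma summable_rhoTilde_sq {γ : ℝ} (h0 : 0 < γ) (h1 : γ < 1) :
    Summable (fun j : ℤ ↦ rhoTilde γ j ^ 2) := by
  have h := summable_rhoHat_sq h0 h1
  have ha : Summable (fun j : ℤ ↦ rhoHat γ (j + 1) ^ 2) :=
    h.comp_injective (i := fun j : ℤ ↦ j + 1) fun a b h ↦ by simpa using h
  have hb : Summable (fun j : ℤ ↦ rhoHat γ (j - 1) ^ 2) :=
    h.comp_injective (i := fun j : ℤ ↦ j - 1) fun a b h ↦ by simpa using h
  -- This is `(a + b + c)² ≤ 3 (a² + b² + c²)` with `b = 2 ρ̂(j)`.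
  refine (((ha.add (h.mul_left 4)).add hb).mul_left 3).of_nonneg_of_le (fun j ↦ sq_nonneg _)
    fun j ↦ ?_
  rw [rhoTilde_eq]
  nlinarith [sq_nonneg (rhoHat γ (j + 1) - 2 * rhoHat γ j),
    sq_nonneg (rhoHat γ (j + 1) - rhoHat γ (j - 1)), sq_nonneg (2 * rhoHat γ j - rhoHat γ (j - 1))]

lemma summable_rhoHat_succ_sq {γ : ℝ} (h0 : 0 < γ) (h1 : γ < 1) :
    Summable (fun j : ℕ ↦ rhoHat γ ((j : ℤ) + 1) ^ 2) :=
  (summable_rhoHat_sq h0 h1).comp_injective (i := fun j : ℕ ↦ (j : ℤ) + 1)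
    fun a b h ↦ by simpa using h

lemma rhoHat_zero {γ : ℝ} (h0 : 0 < γ) : rhoHat γ 0 = 4 - 2 ^ (2 * γ) := by
  simp [rhoHat, Real.zero_rpow (by positivity : 2 * γ ≠ 0)]
  ring

lemma tsum_rhoHat_sq {γ : ℝ} (h0 : 0 < γ) (h1 : γ < 1) :
    ∑' j : ℤ, rhoHat γ j ^ 2 =
      (4 - 2 ^ (2 * γ)) ^ 2 + 2 * ∑' j : ℕ, rhoHat γ ((j : ℤ) + 1) ^ 2 := by
  have h := summable_rhoHat_succ_sq h0 h1
  have hneg : Summable (fun j : ℕ ↦ rhoHat γ (-((j : ℤ) + 1)) ^ 2) := by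
    simpa only [rhoHat_neg] using h
  have key := tsum_of_add_one_of_neg_add_one (f := fun j : ℤ ↦ rhoHat γ j ^ 2) h hneg
  simp only [rhoHat_neg, rhoHat_zero h0] at key
  rw [key]
  ring

lemma four_sub_two_rpow_pos {γ : ℝ} (h1 : γ < 1) : (0 : ℝ) < 4 - 2 ^ (2 * γ) := by
  have : (2 : ℝ) ^ (2 * γ) < 2 ^ (2 : ℝ) :=
    Real.rpow_lt_rpow_of_exponent_lt one_lt_two (by linarith)
  norm_num at this
  linarith

/-! ### Averages over lattice differences. -/

/-- Averages along a lattice: `n⁻¹ ∑_{j < n, k < pn} g(pj - k) → ∑_l g(l)`. -/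
lemma tendsto_inv_mul_sum_sum_tsum {g : ℤ → ℝ} (hg : Summable g) (hg0 : ∀ l, 0 ≤ g l) {p : ℕ}
    (hp : 1 ≤ p) :
    Tendsto (fun n : ℕ ↦ (1 / (n : ℝ)) * ∑ j ∈ Finset.Icc 1 (n - 1),
      ∑ k ∈ Finset.Icc 1 (p * n - 1), g ((p : ℤ) * j - k)) atTop (𝓝 (∑' l, g l)) := by
  classical
  -- The number of pairs `(j, k)` with `pj - k = l`, as `j` and `l` determine `k`. It lies between
  -- `n - 1 - 2|l|` and `n`, so `N / n → 1` and dominated convergence applies with majorant `g`.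
  set N : ℕ → ℤ → ℕ := fun n l ↦ (Finset.filter (fun j : ℕ ↦ 1 ≤ (p : ℤ) * j - l ∧
    (p : ℤ) * j - l ≤ (p : ℤ) * n - 1) (Finset.Icc 1 (n - 1))).card with hN
  have hle (n : ℕ) (l : ℤ) : (N n l : ℝ) ≤ n := by
    have : N n l ≤ n := (Finset.card_filter_le _ _).trans (by simp)
    exact_mod_cast this
  have hge (n : ℕ) (l : ℤ) : (n : ℝ) - 1 - 2 * |l| ≤ N n l := by
    have h1 : Finset.Icc (l.natAbs + 1) (n - 1 - l.natAbs) ⊆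
        Finset.filter (fun j : ℕ ↦ 1 ≤ (p : ℤ) * j - l ∧
          (p : ℤ) * j - l ≤ (p : ℤ) * n - 1) (Finset.Icc 1 (n - 1)) := by
      intro j hj
      rw [Finset.mem_Icc] at hj
      have hp' : (1 : ℤ) ≤ p := by exact_mod_cast hp
      have a0 := Int.natCast_natAbs l
      have a1 : (1 : ℤ) + |l| ≤ j := by omega
      have a2 : (j : ℤ) + 1 + |l| ≤ n := by omega
      have a3 := le_abs_self l
      have a4 := neg_abs_le l
      have a5 := abs_nonneg l
      simp only [Finset.mem_filter, Finset.mem_Icc]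
      refine ⟨by omega, ?_, ?_⟩ <;> nlinarith
    have h2 := Finset.card_le_card h1
    rw [Nat.card_Icc] at h2
    have h3 : (n : ℤ) - 1 - 2 * |l| ≤ N n l := by
      have := Int.natCast_natAbs l
      simp only [hN]
      omega
    exact_mod_cast h3
  have hsum (n : ℕ) (hn : 1 ≤ n) : (1 / (n : ℝ)) * ∑ j ∈ Finset.Icc 1 (n - 1),
      ∑ k ∈ Finset.Icc 1 (p * n - 1), g ((p : ℤ) * j - k) = ∑' l, (N n l / n : ℝ) * g l := by
    have e1 (j : ℕ) : ∑ k ∈ Finset.Icc 1 (p * n - 1), g ((p : ℤ) * j - k) =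
        ∑' l, (if 1 ≤ (p : ℤ) * j - l ∧ (p : ℤ) * j - l ≤ (p : ℤ) * n - 1 then 1 else 0) * g l := by
      have hpn : 1 ≤ p * n := Nat.one_le_iff_ne_zero.2 (by positivity)
      rw [tsum_eq_sum (s := (Finset.Icc 1 (p * n - 1)).image fun k : ℕ ↦ (p : ℤ) * j - k)]
      · rw [Finset.sum_image (by intro a _ b _ h; simpa using h)]
        refine Finset.sum_congr rfl fun k hk ↦ ?_
        rw [Finset.mem_Icc] at hk
        rw [if_pos, one_mul]
        zify [hpn] at hk
        constructor <;> linarith [hk.1, hk.2]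
      · intro l hl
        rw [if_neg, zero_mul]
        rintro ⟨h1, h2⟩
        refine hl (Finset.mem_image.2 ⟨((p : ℤ) * j - l).toNat, ?_, ?_⟩)
        · rw [Finset.mem_Icc]
          zify [hpn]
          rw [Int.toNat_of_nonneg (by linarith)]
          exact ⟨h1, h2⟩
        · rw [Int.toNat_of_nonneg (by linarith)]
          ring
    simp only [e1]
    rw [← Summable.tsum_finsetSum, ← tsum_mul_left]
    · refine tsum_congr fun l ↦ ?_
      rw [← Finset.sum_mul, Finset.sum_boole]
      simp only [hN]
      ring
    · intro j _
      refine hg.of_nonneg_of_le (fun l ↦ ?_) fun l ↦ ?_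
      · split_ifs <;> simp [hg0]
      · split_ifs <;> simp [hg0]
  have hlim : Tendsto (fun n : ℕ ↦ ∑' l, (N n l / n : ℝ) * g l) atTop (𝓝 (∑' l, 1 * g l)) := by
    refine tendsto_tsum_of_dominated_convergence hg (fun l ↦ ?_) ?_
    · refine Tendsto.mul_const _ ?_
      have h1 : Tendsto (fun n : ℕ ↦ 1 - (1 + 2 * |(l : ℝ)|) / (n : ℝ)) atTop (𝓝 1) := by
        simpa using (tendsto_const_div_atTop_nhds_zero_nat (1 + 2 * |(l : ℝ)|)).const_sub 1
      refine tendsto_of_tendsto_of_tendsto_of_le_of_le' h1 tendsto_const_nhds ?_ ?_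
      · filter_upwards [eventually_ge_atTop 1] with n hn
        have hn0 : (0 : ℝ) < n := by exact_mod_cast hn
        have := hge n l
        push_cast at this
        rw [le_div_iff₀ hn0, sub_mul, div_mul_cancel₀ _ hn0.ne']
        linarith
      · filter_upwards [eventually_ge_atTop 1] with n hn
        exact div_le_one_of_le₀ (hle n l) (Nat.cast_nonneg n)
    · filter_upwards with n l
      rw [norm_mul, Real.norm_eq_abs, Real.norm_eq_abs, abs_of_nonneg (hg0 l),
        abs_of_nonneg (by positivity)]
      exact mul_le_of_le_one_left (hg0 l) (div_le_one_of_le₀ (hle n l) (Nat.cast_nonneg n))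
  simp only [one_mul] at hlim
  refine hlim.congr' ?_
  filter_upwards [eventually_ge_atTop 1] with n hn
  rw [hsum n hn]

/-! ### Normalized increments of a centred Gaussian process. -/

section CenteredGaussian

variable {Ω : Type*} [MeasurableSpace Ω] {P : Measure Ω} {T : ℝ} {X : ℝ → Ω → ℝ}

lemma div_mul_mem_Icc (hT : 0 < T) {a : ℝ} {m : ℕ} (h0 : 0 ≤ a) (h1 : a ≤ m) :
    a / m * T ∈ Set.Icc (0 : ℝ) T :=
  ⟨by positivity, mul_le_of_le_one_left hT.le (div_le_one_of_le₀ h1 (Nat.cast_nonneg m))⟩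

lemma times_mem_Icc (hT : 0 < T) {m k : ℕ} (hk : k ∈ Finset.Icc 1 (m - 1)) :
    ((k : ℝ) + 1) / m * T ∈ Set.Icc (0 : ℝ) T ∧ (k : ℝ) / m * T ∈ Set.Icc (0 : ℝ) T ∧
      ((k : ℝ) - 1) / m * T ∈ Set.Icc (0 : ℝ) T := by
  rw [Finset.mem_Icc] at hk
  have h1 : (1 : ℝ) ≤ k := by exact_mod_cast hk.1
  have h2 : (k : ℝ) + 1 ≤ m := by
    have : k + 1 ≤ m := by omega
    exact_mod_cast this
  exact ⟨div_mul_mem_Icc hT (by linarith) (by linarith),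
    div_mul_mem_Icc hT (by linarith) (by linarith), div_mul_mem_Icc hT (by linarith) (by linarith)⟩

/-- Pairs `(m, k)` with `1 ≤ k ≤ m - 1`. -/
abbrev MeshIndex : Type := {q : ℕ × ℕ // q.2 ∈ Finset.Icc 1 (q.1 - 1)}

/-- Indexing by all meshes at once gives joint Gaussianity of increments from different meshes,
needed for cross covariances and for the stacked vector. -/
lemma IsCenteredGaussianOn.isGaussianProcess_normIncr (hX : IsCenteredGaussianOn P T X)
    (hT : 0 < T) :
    IsGaussianProcess (fun (q : MeshIndex) ω ↦ normIncr P T X q.1.1 q.1.2 ω) P := by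
  classical
  refine hX.gaussian.of_isGaussianProcess fun q ↦ ?_
  obtain ⟨h1, h2, h3⟩ := times_mem_Icc hT q.2
  set a : Set.Icc (0 : ℝ) T := ⟨_, h1⟩
  set b : Set.Icc (0 : ℝ) T := ⟨_, h2⟩
  set c : Set.Icc (0 : ℝ) T := ⟨_, h3⟩
  let I : Finset (Set.Icc (0 : ℝ) T) := {a, b, c}
  let pr (i : I) : (I → ℝ) →L[ℝ] ℝ := ContinuousLinearMap.proj i
  refine ⟨I, (√(∫ ω', secondIncr T X q.1.1 q.1.2 ω' ^ 2 ∂P))⁻¹ •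
    (pr ⟨a, by simp [I]⟩ - (2 : ℝ) • pr ⟨b, by simp [I]⟩ + pr ⟨c, by simp [I]⟩), fun ω ↦ ?_⟩
  simp only [normIncr, secondIncr, pr, a, b, c, _root_.smul_apply,
    _root_.add_apply, _root_.sub_apply, ContinuousLinearMap.proj_apply,
    Finset.restrict, smul_eq_mul]
  ring

lemma IsCenteredGaussianOn.memLp (hX : IsCenteredGaussianOn P T X) {t : ℝ}
    (ht : t ∈ Set.Icc 0 T) : MemLp (X t) 2 P :=
  (hX.gaussian.hasGaussianLaw_eval ⟨t, ht⟩).memLp_two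

lemma IsCenteredGaussianOn.memLp_secondIncr (hX : IsCenteredGaussianOn P T X) (hT : 0 < T)
    {m k : ℕ} (hk : k ∈ Finset.Icc 1 (m - 1)) : MemLp (secondIncr T X m k) 2 P := by
  obtain ⟨h1, h2, h3⟩ := times_mem_Icc hT hk
  exact ((hX.memLp h1).sub ((hX.memLp h2).const_mul 2)).add (hX.memLp h3)

lemma IsCenteredGaussianOn.hasGaussianLaw_normIncr (hX : IsCenteredGaussianOn P T X) (hT : 0 < T)
    {m k : ℕ} (hk : k ∈ Finset.Icc 1 (m - 1)) : HasGaussianLaw (normIncr P T X m k) P :=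
  (hX.isGaussianProcess_normIncr hT).hasGaussianLaw_eval ⟨(m, k), hk⟩

lemma IsCenteredGaussianOn.integral_normIncr (hX : IsCenteredGaussianOn P T X) (hT : 0 < T)
    {m k : ℕ} (hk : k ∈ Finset.Icc 1 (m - 1)) : ∫ ω, normIncr P T X m k ω ∂P = 0 := by
  have := hX.gaussian.isProbabilityMeasure
  obtain ⟨h1, h2, h3⟩ := times_mem_Icc hT hk
  have i1 := (hX.memLp h1).integrable one_le_two
  have i2 := ((hX.memLp h2).integrable one_le_two).const_mul 2
  have i3 := (hX.memLp h3).integrable one_le_two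
  have i12 : Integrable (fun ω ↦ X (((k : ℝ) + 1) / m * T) ω - 2 * X ((k : ℝ) / m * T) ω) P :=
    i1.sub i2
  simp only [normIncr, secondIncr]
  rw [integral_div, integral_add i12 i3, integral_sub i1 i2, integral_const_mul,
    hX.mean_zero _ h1, hX.mean_zero _ h2, hX.mean_zero _ h3]
  simp

lemma IsCenteredGaussianOn.memLp_normIncr_sq (hX : IsCenteredGaussianOn P T X) (hT : 0 < T)
    {m k : ℕ} (hk : k ∈ Finset.Icc 1 (m - 1)) : MemLp (fun ω ↦ normIncr P T X m k ω ^ 2) 2 P :=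
  HasGaussianLaw.memLp_sq (hX.hasGaussianLaw_normIncr hT hk)

lemma IsCenteredGaussianOn.memLp_quadVar (hX : IsCenteredGaussianOn P T X) (hT : 0 < T)
    (m : ℕ) : MemLp (quadVar P T X m) 2 P :=
  memLp_finsetSum _ fun _ hk ↦ hX.memLp_normIncr_sq hT hk

lemma IsCenteredGaussianOn.covariance_quadVar (hX : IsCenteredGaussianOn P T X) (hT : 0 < T)
    (m m' : ℕ) : cov[quadVar P T X m, quadVar P T X m'; P] =
      ∑ j ∈ Finset.Icc 1 (m - 1), ∑ k ∈ Finset.Icc 1 (m' - 1),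
        2 * (∫ ω, normIncr P T X m j ω * normIncr P T X m' k ω ∂P) ^ 2 := by
  have := hX.gaussian.isProbabilityMeasure
  have h := covariance_fun_sum_fun_sum' (μ := P) (s := Finset.Icc 1 (m - 1))
    (t := Finset.Icc 1 (m' - 1)) (X := fun k ω ↦ normIncr P T X m k ω ^ 2)
    (Y := fun k ω ↦ normIncr P T X m' k ω ^ 2)
    (fun k hk ↦ hX.memLp_normIncr_sq hT hk) (fun k hk ↦ hX.memLp_normIncr_sq hT hk)
  refine h.trans (Finset.sum_congr rfl fun j hj ↦ Finset.sum_congr rfl fun k hk ↦ ?_)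
  exact covariance_sq_sq ((hX.isGaussianProcess_normIncr hT).hasGaussianLaw_prodMk
    (s := ⟨(m, j), hj⟩) (t := ⟨(m', k), hk⟩)) (hX.integral_normIncr hT hj)
    (hX.integral_normIncr hT hk)

/-- Schur test: the covariance operator of the increments at mesh `m` is bounded by the largest
absolute row sum. -/
lemma IsCenteredGaussianOn.integral_sum_normIncr_sq_le (hX : IsCenteredGaussianOn P T X)
    (hT : 0 < T) {m : ℕ} {C : ℝ}
    (hC : ∀ k ∈ Finset.Icc 1 (m - 1), ∑ j ∈ Finset.Icc 1 (m - 1), |incrCov P T X m j k| ≤ C)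
    (v : ℕ → ℝ) :
    ∫ ω, (∑ k ∈ Finset.Icc 1 (m - 1), v k * normIncr P T X m k ω) ^ 2 ∂P
      ≤ C * ∑ k ∈ Finset.Icc 1 (m - 1), v k ^ 2 := by
  set s := Finset.Icc 1 (m - 1)
  have hm (k) (hk : k ∈ s) : MemLp (normIncr P T X m k) 2 P :=
    (hX.hasGaussianLaw_normIncr hT hk).memLp_two
  have e : ∫ ω, (∑ k ∈ s, v k * normIncr P T X m k ω) ^ 2 ∂P =
      ∑ j ∈ s, ∑ k ∈ s, v j * v k * incrCov P T X m j k := by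
    have e0 (ω) : (∑ k ∈ s, v k * normIncr P T X m k ω) ^ 2 =
        ∑ j ∈ s, ∑ k ∈ s, v j * v k * (normIncr P T X m j ω * normIncr P T X m k ω) := by
      rw [sq, Finset.sum_mul_sum]
      exact Finset.sum_congr rfl fun i _ ↦ Finset.sum_congr rfl fun j _ ↦ by ring
    have hi (j) (hj : j ∈ s) (k) (hk : k ∈ s) :
        Integrable (fun ω ↦ v j * v k * (normIncr P T X m j ω * normIncr P T X m k ω)) P :=
      ((hm j hj).integrable_mul (hm k hk)).const_mul _
    simp only [e0]
    rw [integral_finsetSum _ fun j hj ↦ integrable_finsetSum _ (hi j hj)]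
    refine Finset.sum_congr rfl fun j hj ↦ ?_
    rw [integral_finsetSum _ (hi j hj)]
    exact Finset.sum_congr rfl fun k _ ↦ integral_const_mul _ _
  have hsymm (j k) : incrCov P T X m j k = incrCov P T X m k j := by
    simp only [incrCov, mul_comm]
  rw [e]
  -- Bound `|v_j v_k|` by `(v_j² + v_k²) / 2`; by symmetry of the covariance both halves have the
  -- same sum.
  calc _ ≤ ∑ j ∈ s, ∑ k ∈ s, (v j ^ 2 / 2 * |incrCov P T X m k j| +
        v k ^ 2 / 2 * |incrCov P T X m j k|) := by
        refine Finset.sum_le_sum fun j _ ↦ Finset.sum_le_sum fun k _ ↦ ?_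
        rw [hsymm k j, ← add_mul]
        have h1 : |v j * v k| ≤ v j ^ 2 / 2 + v k ^ 2 / 2 := by
          rw [abs_le]
          constructor <;> nlinarith [sq_nonneg (v j + v k), sq_nonneg (v j - v k)]
        calc _ ≤ |v j * v k * incrCov P T X m j k| := le_abs_self _
          _ ≤ _ := by rw [abs_mul]; gcongr
    _ = ∑ j ∈ s, v j ^ 2 * ∑ k ∈ s, |incrCov P T X m k j| := by
        simp only [Finset.sum_add_distrib]
        rw [Finset.sum_comm (f := fun j k ↦ v k ^ 2 / 2 * |incrCov P T X m j k|),
          ← Finset.sum_add_distrib]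
        refine Finset.sum_congr rfl fun j _ ↦ ?_
        rw [← Finset.mul_sum, ← add_mul, add_halves]
    _ ≤ ∑ j ∈ s, v j ^ 2 * C :=
        Finset.sum_le_sum fun j hj ↦ mul_le_mul_of_nonneg_left (hC j hj) (sq_nonneg _)
    _ = _ := by rw [← Finset.sum_mul, mul_comm]

end CenteredGaussian

/-! ### Increment covariances of fractional Brownian motion. -/

section FractionalBrownianMotion

variable {Ω : Type*} [MeasurableSpace Ω] {P : Measure Ω} {T γ : ℝ} {B : ℝ → Ω → ℝ}

lemma integral_secondIncr_mul {X : ℝ → Ω → ℝ} (hX : IsCenteredGaussianOn P T X) (hT : 0 < T)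
    {m k : ℕ} (hk : k ∈ Finset.Icc 1 (m - 1)) {W : Ω → ℝ} (hW : MemLp W 2 P) :
    ∫ ω, secondIncr T X m k ω * W ω ∂P =
      ∫ ω, X (((k : ℝ) + 1) / m * T) ω * W ω ∂P - 2 * ∫ ω, X ((k : ℝ) / m * T) ω * W ω ∂P
        + ∫ ω, X (((k : ℝ) - 1) / m * T) ω * W ω ∂P := by
  obtain ⟨h1, h2, h3⟩ := times_mem_Icc hT hk
  have i1 : Integrable (fun ω ↦ X (((k : ℝ) + 1) / m * T) ω * W ω) P :=
    (hX.memLp h1).integrable_mul hW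
  have i2 : Integrable (fun ω ↦ 2 * (X ((k : ℝ) / m * T) ω * W ω)) P :=
    ((hX.memLp h2).integrable_mul hW).const_mul 2
  have i3 : Integrable (fun ω ↦ X (((k : ℝ) - 1) / m * T) ω * W ω) P :=
    (hX.memLp h3).integrable_mul hW
  have i12 : Integrable (fun ω ↦ X (((k : ℝ) + 1) / m * T) ω * W ω
    - 2 * (X ((k : ℝ) / m * T) ω * W ω)) P := i1.sub i2
  rw [← integral_const_mul, ← integral_sub i1 i2, ← integral_add i12 i3]
  congr 1 with ω
  simp only [secondIncr]
  ring

/-- Covariance, in units of the finer mesh, of two second-order increments of fractional Brownian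
motion whose meshes have ratio `p` and whose centres are `l` fine steps apart. -/
noncomputable def crossRho (γ : ℝ) (p : ℕ) (l : ℤ) : ℝ :=
  -(1 / 2) * ((|(l : ℝ) + p - 1| ^ (2 * γ) - 2 * |(l : ℝ) + p| ^ (2 * γ)
      + |(l : ℝ) + p + 1| ^ (2 * γ))
    - 2 * (|(l : ℝ) - 1| ^ (2 * γ) - 2 * |(l : ℝ)| ^ (2 * γ) + |(l : ℝ) + 1| ^ (2 * γ))
    + (|(l : ℝ) - p - 1| ^ (2 * γ) - 2 * |(l : ℝ) - p| ^ (2 * γ) + |(l : ℝ) - p + 1| ^ (2 * γ)))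

lemma crossRho_one (γ : ℝ) (l : ℤ) : crossRho γ 1 l = rhoHat γ l := by
  simp only [crossRho, rhoHat, Nat.cast_one]
  rw [show (l : ℝ) + 1 - 1 = l by ring, show (l : ℝ) + 1 + 1 = l + 2 by ring,
    show (l : ℝ) - 1 - 1 = l - 2 by ring, show (l : ℝ) - 1 + 1 = l by ring]
  ring

lemma crossRho_two (γ : ℝ) (l : ℤ) : crossRho γ 2 l = rhoTilde γ l := by
  simp only [crossRho, rhoTilde, Nat.cast_ofNat]
  rw [show (l : ℝ) + 2 - 1 = l + 1 by ring, show (l : ℝ) + 2 + 1 = l + 3 by ring,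
    show (l : ℝ) - 2 - 1 = l - 3 by ring, show (l : ℝ) - 2 + 1 = l - 1 by ring]
  ring

/-- Second differences in both times annihilate the terms of the covariance that depend on one time
only; self-similarity extracts the power of the fine mesh. -/
lemma IsFractionalBrownianMotion.integral_secondIncr_mul_secondIncr
    (hB : IsFractionalBrownianMotion P T γ B) (hT : 0 < T) {p m j k : ℕ} (hp : 1 ≤ p)
    (hm : 1 ≤ m) (hj : j ∈ Finset.Icc 1 (m - 1)) (hk : k ∈ Finset.Icc 1 (p * m - 1)) :
    ∫ ω, secondIncr T B m j ω * secondIncr T B (p * m) k ω ∂P =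
      (T / (p * m)) ^ (2 * γ) * crossRho γ p ((p : ℤ) * j - k) := by
  have hc := hB.centeredGaussian
  obtain ⟨s1, s2, s3⟩ := times_mem_Icc hT hj
  obtain ⟨t1, t2, t3⟩ := times_mem_Icc hT hk
  have hp0 : (0 : ℝ) < p := by exact_mod_cast hp
  have hm0 : (0 : ℝ) < m := by exact_mod_cast hm
  have hD (a b : ℝ) : |a / m * T - b / (p * m : ℕ) * T| ^ (2 * γ) =
      (T / (p * m)) ^ (2 * γ) * |p * a - b| ^ (2 * γ) := by
    have : a / m * T - b / (p * m : ℕ) * T = T / (p * m) * (p * a - b) := by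
      push_cast
      field_simp
    rw [this, abs_mul, abs_of_pos (by positivity), Real.mul_rpow (by positivity) (abs_nonneg _)]
  have hW := hc.memLp_secondIncr hT hk
  have hin {s : ℝ} (hs : s ∈ Set.Icc 0 T) :
      ∫ ω, B s ω * secondIncr T B (p * m) k ω ∂P =
        -(1 / 2) * (|s - ((k : ℝ) + 1) / (p * m : ℕ) * T| ^ (2 * γ)
          - 2 * |s - (k : ℝ) / (p * m : ℕ) * T| ^ (2 * γ)
          + |s - ((k : ℝ) - 1) / (p * m : ℕ) * T| ^ (2 * γ)) +
        (1 / 2) * ((((k : ℝ) + 1) / (p * m : ℕ) * T) ^ (2 * γ)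
          - 2 * ((k : ℝ) / (p * m : ℕ) * T) ^ (2 * γ)
          + (((k : ℝ) - 1) / (p * m : ℕ) * T) ^ (2 * γ)) := by
    have := integral_secondIncr_mul hc hT hk (hc.memLp hs)
    simp only [mul_comm (B s _)]
    rw [this]
    simp only [mul_comm _ (B s _)]
    rw [hB.covariance_eq _ hs _ t1, hB.covariance_eq _ hs _ t2, hB.covariance_eq _ hs _ t3]
    ring
  rw [integral_secondIncr_mul hc hT hj hW, hin s1, hin s2, hin s3]
  simp only [hD, crossRho]
  push_cast
  rw [show (p : ℝ) * (j + 1) - (k + 1) = p * j - k + p - 1 by ring,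
    show (p : ℝ) * (j + 1) - k = p * j - k + p by ring,
    show (p : ℝ) * (j + 1) - (k - 1) = p * j - k + p + 1 by ring,
    show (p : ℝ) * j - (k + 1) = p * j - k - 1 by ring,
    show (p : ℝ) * j - (k - 1) = p * j - k + 1 by ring,
    show (p : ℝ) * (j - 1) - (k + 1) = p * j - k - p - 1 by ring,
    show (p : ℝ) * (j - 1) - k = p * j - k - p by ring,
    show (p : ℝ) * (j - 1) - (k - 1) = p * j - k - p + 1 by ring]
  ring

lemma IsFractionalBrownianMotion.integral_secondIncr_sq
    (hB : IsFractionalBrownianMotion P T γ B) (hT : 0 < T) {m k : ℕ}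
    (hm : 1 ≤ m) (hk : k ∈ Finset.Icc 1 (m - 1)) :
    ∫ ω, secondIncr T B m k ω ^ 2 ∂P = (T / m) ^ (2 * γ) * (4 - 2 ^ (2 * γ)) := by
  have h := hB.integral_secondIncr_mul_secondIncr hT (p := 1) le_rfl hm hk (by simpa using hk)
  simpa [crossRho_one, rhoHat_zero hB.hurst_pos, ← sq] using h

/-- The mesh cancels on normalizing, except that the coarse variance is `p^{2γ}` times the fine one;
this is the origin of `2^{-2γ}` in `sigma12`. -/
lemma IsFractionalBrownianMotion.integral_normIncr_mul_normIncr_sq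
    (hB : IsFractionalBrownianMotion P T γ B) (hT : 0 < T) {p m j k : ℕ} (hp : 1 ≤ p)
    (hm : 1 ≤ m) (hj : j ∈ Finset.Icc 1 (m - 1)) (hk : k ∈ Finset.Icc 1 (p * m - 1)) :
    (∫ ω, normIncr P T B m j ω * normIncr P T B (p * m) k ω ∂P) ^ 2 =
      1 / ((p : ℝ) ^ (2 * γ) * (4 - 2 ^ (2 * γ)) ^ 2) * crossRho γ p ((p : ℤ) * j - k) ^ 2 := by
  have hp0 : (0 : ℝ) < p := by exact_mod_cast hp
  have hm0 : (0 : ℝ) < m := by exact_mod_cast hm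
  have hpm : 1 ≤ p * m := Nat.one_le_iff_ne_zero.2 (by positivity)
  have hD := four_sub_two_rpow_pos hB.hurst_lt_one
  simp only [normIncr, div_mul_div_comm]
  rw [integral_div, hB.integral_secondIncr_mul_secondIncr hT hp hm hj hk,
    hB.integral_secondIncr_sq hT hm hj, hB.integral_secondIncr_sq hT hpm hk, div_pow, mul_pow,
    mul_pow, Real.sq_sqrt (by positivity), Real.sq_sqrt (by positivity)]
  have e : (T / m) ^ (2 * γ) = (p : ℝ) ^ (2 * γ) * (T / (p * m)) ^ (2 * γ) := by
    rw [← Real.mul_rpow hp0.le (by positivity)]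
    congr 1
    field_simp
  rw [e, Nat.cast_mul]
  have h1 : (0 : ℝ) < (T / (p * m)) ^ (2 * γ) := by positivity
  have h2 : (0 : ℝ) < (p : ℝ) ^ (2 * γ) := by positivity
  field_simp

lemma IsFractionalBrownianMotion.tendsto_covariance_quadVar
    (hB : IsFractionalBrownianMotion P T γ B) (hT : 0 < T) {p : ℕ} (hp : 1 ≤ p)
    (hs : Summable fun l ↦ crossRho γ p l ^ 2) :
    Tendsto (fun n : ℕ ↦ (1 / (n : ℝ)) * cov[quadVar P T B n, quadVar P T B (p * n); P]) atTop
      (𝓝 (2 / ((p : ℝ) ^ (2 * γ) * (4 - 2 ^ (2 * γ)) ^ 2) * ∑' l, crossRho γ p l ^ 2)) := by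
  have h := (tendsto_inv_mul_sum_sum_tsum hs (fun l ↦ sq_nonneg _) hp).const_mul
    (2 / ((p : ℝ) ^ (2 * γ) * (4 - 2 ^ (2 * γ)) ^ 2))
  refine h.congr' ?_
  filter_upwards [eventually_ge_atTop 1] with n hn
  rw [hB.centeredGaussian.covariance_quadVar hT, mul_left_comm]
  congr 1
  rw [Finset.mul_sum]
  refine Finset.sum_congr rfl fun j hj ↦ ?_
  rw [Finset.mul_sum]
  refine Finset.sum_congr rfl fun k hk ↦ ?_
  rw [hB.integral_normIncr_mul_normIncr_sq hT hp hn hj hk]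
  ring

end FractionalBrownianMotion

/-! ### Limiting covariances and the characteristic function bound. -/

section Limits

variable {Ω : Type*} [MeasurableSpace Ω] {P : Measure Ω} {T γ : ℝ} {B X : ℝ → Ω → ℝ}

/-- `n⁻¹ cov(i⁻¹ V_{in}, j⁻¹ V_{jn})`. -/
noncomputable def scaledCov (P : Measure Ω) (T : ℝ) (X : ℝ → Ω → ℝ) (i j n : ℕ) : ℝ :=
  (1 / (n : ℝ)) * cov[fun ω ↦ (i : ℝ)⁻¹ * quadVar P T X (i * n) ω,
    fun ω ↦ (j : ℝ)⁻¹ * quadVar P T X (j * n) ω; P]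

lemma scaledCov_eq (i j n : ℕ) : scaledCov P T X i j n =
    (1 / (n : ℝ)) * ((i : ℝ)⁻¹ * ((j : ℝ)⁻¹ *
      cov[quadVar P T X (i * n), quadVar P T X (j * n); P])) := by
  rw [scaledCov, covariance_const_mul_left, covariance_const_mul_right]

lemma IsFractionalBrownianMotion.tendsto_covariance_quadVar_self
    (hB : IsFractionalBrownianMotion P T γ B) (hT : 0 < T) :
    Tendsto (fun n : ℕ ↦ (1 / (n : ℝ)) * cov[quadVar P T B n, quadVar P T B n; P]) atTop
      (𝓝 (sigma11 γ)) := by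
  have hD := four_sub_two_rpow_pos hB.hurst_lt_one
  have h := hB.tendsto_covariance_quadVar hT le_rfl (by
    simpa only [crossRho_one] using summable_rhoHat_sq hB.hurst_pos hB.hurst_lt_one)
  simp only [crossRho_one, one_mul, Nat.cast_one, Real.one_rpow,
    tsum_rhoHat_sq hB.hurst_pos hB.hurst_lt_one] at h
  convert! h using 2
  rw [sigma11]
  field_simp

lemma IsFractionalBrownianMotion.tendsto_scaledCov_one_one
    (hB : IsFractionalBrownianMotion P T γ B) (hT : 0 < T) :
    Tendsto (scaledCov P T B 1 1) atTop (𝓝 (sigma11 γ)) := by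
  refine (hB.tendsto_covariance_quadVar_self hT).congr fun n ↦ ?_
  simp [scaledCov_eq]

/-- The weight `1/4` with the factor `1/n` is `1/2` times the natural normalization `1/(2n)` at mesh
`2n`. -/
lemma IsFractionalBrownianMotion.tendsto_scaledCov_two_two
    (hB : IsFractionalBrownianMotion P T γ B) (hT : 0 < T) :
    Tendsto (scaledCov P T B 2 2) atTop (𝓝 ((1 / 2) * sigma11 γ)) := by
  have h2 : Tendsto (fun n : ℕ ↦ 2 * n) atTop atTop :=
    tendsto_id.const_mul_atTop' two_pos
  refine (((hB.tendsto_covariance_quadVar_self hT).comp h2).const_mul (1 / 2)).congr fun n ↦ ?_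
  simp only [scaledCov_eq, Function.comp_apply]
  push_cast
  rw [one_div_mul_eq_div, one_div_mul_eq_div]
  ring

lemma IsFractionalBrownianMotion.tendsto_scaledCov_one_two
    (hB : IsFractionalBrownianMotion P T γ B) (hT : 0 < T) :
    Tendsto (scaledCov P T B 1 2) atTop (𝓝 (sigma12 γ)) := by
  have h := hB.tendsto_covariance_quadVar hT one_le_two (by
    simpa only [crossRho_two] using summable_rhoTilde_sq hB.hurst_pos hB.hurst_lt_one)
  have h' := h.const_mul (1 / 2)
  simp only [crossRho_two] at h'
  have e : (1 / 2 : ℝ) * (2 / (((2 : ℕ) : ℝ) ^ (2 * γ) * (4 - 2 ^ (2 * γ)) ^ 2) *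
      ∑' l, rhoTilde γ l ^ 2) = sigma12 γ := by
    rw [sigma12]
    push_cast
    ring
  rw [e] at h'
  refine h'.congr fun n ↦ ?_
  simp only [scaledCov_eq, one_mul, Nat.cast_one, inv_one]
  push_cast
  ring

lemma IsCenteredGaussianOn.variance_add_quadVar (hX : IsCenteredGaussianOn P T X) (hT : 0 < T)
    (a b : ℝ) (n : ℕ) :
    Var[fun ω ↦ a * (√n * (n : ℝ)⁻¹) * quadVar P T X n ω +
        b * (√n * (2 * (n : ℝ))⁻¹) * quadVar P T X (2 * n) ω; P] =
      a ^ 2 * scaledCov P T X 1 1 n + 2 * (a * b) * scaledCov P T X 1 2 n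
        + b ^ 2 * scaledCov P T X 2 2 n := by
  have := hX.gaussian.isProbabilityMeasure
  have h1 := (hX.memLp_quadVar hT n).const_mul (a * (√n * (n : ℝ)⁻¹))
  have h2 := (hX.memLp_quadVar hT (2 * n)).const_mul (b * (√n * (2 * (n : ℝ))⁻¹))
  rw [variance_fun_add h1 h2, variance_const_mul, variance_const_mul, covariance_const_mul_left,
    covariance_const_mul_right, ← covariance_self (hX.memLp_quadVar hT n).aemeasurable,
    ← covariance_self (hX.memLp_quadVar hT (2 * n)).aemeasurable]
  simp only [scaledCov_eq, one_mul, Nat.cast_one, inv_one]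
  have hs : √(n : ℝ) ^ 2 = n := Real.sq_sqrt (Nat.cast_nonneg n)
  -- At `n = 0` both sides vanish, since the inverse of zero is zero.
  rcases eq_or_ne (n : ℝ) 0 with h | h
  · simp [h]
  · push_cast
    field_simp
    rw [hs]

lemma dotProduct_sigmaFBM_mulVec (γ : ℝ) (v : Fin 2 → ℝ) :
    dotProduct v ((sigmaFBM γ).mulVec v) =
      v 0 ^ 2 * sigma11 γ + 2 * (v 0 * v 1) * sigma12 γ + v 1 ^ 2 * ((1 / 2) * sigma11 γ) := by
  simp [sigmaFBM, dotProduct, Matrix.mulVec, Fin.sum_univ_two]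
  ring

lemma IsCenteredGaussianOn.tendsto_variance (hX : IsCenteredGaussianOn P T X) (hT : 0 < T)
    (h11 : Tendsto (scaledCov P T X 1 1) atTop (𝓝 (sigma11 γ)))
    (h12 : Tendsto (scaledCov P T X 1 2) atTop (𝓝 (sigma12 γ)))
    (h22 : Tendsto (scaledCov P T X 2 2) atTop (𝓝 ((1 / 2) * sigma11 γ))) (v : Fin 2 → ℝ) :
    Tendsto (fun n : ℕ ↦ Var[fun ω ↦ v 0 * (√n * (n : ℝ)⁻¹) * quadVar P T X n ω +
        v 1 * (√n * (2 * (n : ℝ))⁻¹) * quadVar P T X (2 * n) ω; P]) atTop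
      (𝓝 (dotProduct v ((sigmaFBM γ).mulVec v))) := by
  simp only [hX.variance_add_quadVar hT, dotProduct_sigmaFBM_mulVec]
  exact ((h11.const_mul _).add (h12.const_mul _)).add (h22.const_mul _)

/-- The quadratic form is a limit of variances of combinations of the variations of `B` itself, so
the series need not be estimated. -/
lemma IsFractionalBrownianMotion.posSemidef_sigmaFBM
    (hB : IsFractionalBrownianMotion P T γ B) (hT : 0 < T) : (sigmaFBM γ).PosSemidef := by
  refine Matrix.PosSemidef.of_dotProduct_mulVec_nonneg ?_ fun v ↦ ?_
  · ext i j
    fin_cases i <;> fin_cases j <;> simp [sigmaFBM]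
  · rw [star_trivial]
    exact ge_of_tendsto' (hB.centeredGaussian.tendsto_variance hT (hB.tendsto_scaledCov_one_one hT)
      (hB.tendsto_scaledCov_one_two hT) (hB.tendsto_scaledCov_two_two hT) v)
      fun n ↦ variance_nonneg _ _

lemma IsCenteredGaussianOn.aemeasurable_centredPair (hX : IsCenteredGaussianOn P T X)
    (hT : 0 < T) (n : ℕ) : AEMeasurable (centredPair P T X n) P := by
  have h1 := (hX.memLp_quadVar hT n).aemeasurable
  have h2 := (hX.memLp_quadVar hT (2 * n)).aemeasurable
  have h : AEMeasurable (fun ω ↦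
      ![(n : ℝ)⁻¹ * (quadVar P T X n ω - ∫ ω', quadVar P T X n ω' ∂P),
        (2 * (n : ℝ))⁻¹ * (quadVar P T X (2 * n) ω - ∫ ω', quadVar P T X (2 * n) ω' ∂P)]) P := by
    refine aemeasurable_pi_iff.2 fun i ↦ ?_
    fin_cases i
    · exact (h1.sub_const _).const_mul _
    · exact (h2.sub_const _).const_mul _
  exact ((WithLp.measurable_toLp 2 (Fin 2 → ℝ)).comp_aemeasurable h).const_smul (√(n : ℝ))

lemma IsCenteredGaussianOn.inner_centredPair (hX : IsCenteredGaussianOn P T X) (hT : 0 < T)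
    (n : ℕ) (v : EuclideanSpace ℝ (Fin 2)) (ω : Ω) :
    ⟪centredPair P T X n ω, v⟫ =
      (v 0 * (√n * (n : ℝ)⁻¹) * quadVar P T X n ω +
        v 1 * (√n * (2 * (n : ℝ))⁻¹) * quadVar P T X (2 * n) ω) -
      ∫ ω', (v 0 * (√n * (n : ℝ)⁻¹) * quadVar P T X n ω' +
        v 1 * (√n * (2 * (n : ℝ))⁻¹) * quadVar P T X (2 * n) ω') ∂P := by
  have := hX.gaussian.isProbabilityMeasure
  have h1 := ((hX.memLp_quadVar hT n).integrable one_le_two).const_mul (v 0 * (√n * (n : ℝ)⁻¹))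
  have h2 := ((hX.memLp_quadVar hT (2 * n)).integrable one_le_two).const_mul
    (v 1 * (√n * (2 * (n : ℝ))⁻¹))
  rw [integral_add h1 h2, integral_const_mul, integral_const_mul]
  simp [centredPair, PiLp.inner_apply, Fin.sum_univ_two]
  ring

/-- Bound on the characteristic function of the normalized pair of quadratic variations. -/
lemma IsCenteredGaussianOn.norm_charFun_centredPair_sub_le (hX : IsCenteredGaussianOn P T X)
    (hT : 0 < T) {ε δ C : ℝ}
    (h : ∀ u : ℝ, |u| ≤ δ →
      ‖∫ x, Complex.exp ((u * (x ^ 2 - 1) : ℝ) * Complex.I) ∂gaussianReal 0 1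
        - (Real.exp (-u ^ 2) : ℂ)‖ ≤ ε * u ^ 2)
    {n : ℕ} (hC1 : ∀ k ∈ Finset.Icc 1 (n - 1),
      ∑ j ∈ Finset.Icc 1 (n - 1), |incrCov P T X n j k| ≤ C)
    (hC2 : ∀ k ∈ Finset.Icc 1 (2 * n - 1),
      ∑ j ∈ Finset.Icc 1 (2 * n - 1), |incrCov P T X (2 * n) j k| ≤ C)
    (v : EuclideanSpace ℝ (Fin 2))
    (hδ : (|v 0| + |v 1|) * (√n * (n : ℝ)⁻¹) * (2 * C) ≤ δ) :
    ‖charFun (P.map (centredPair P T X n)) v - (Real.exp (-Var[fun ω ↦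
        v 0 * (√n * (n : ℝ)⁻¹) * quadVar P T X n ω +
        v 1 * (√n * (2 * (n : ℝ))⁻¹) * quadVar P T X (2 * n) ω; P] / 2) : ℂ)‖ ≤
      ε * (Var[fun ω ↦ v 0 * (√n * (n : ℝ)⁻¹) * quadVar P T X n ω +
        v 1 * (√n * (2 * (n : ℝ))⁻¹) * quadVar P T X (2 * n) ω; P] / 2) := by
  classical
  set s := Finset.Icc 1 (n - 1)
  set s' := Finset.Icc 1 (2 * n - 1)
  set f : s ⊕ s' → MeshIndex :=
    Sum.elim (fun k ↦ ⟨(n, k), k.2⟩) (fun k ↦ ⟨(2 * n, k), k.2⟩)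
  set Z : s ⊕ s' → Ω → ℝ := fun i ω ↦ normIncr P T X (f i).1.1 (f i).1.2 ω
  set w : s ⊕ s' → ℝ :=
    Sum.elim (fun _ ↦ v 0 * (√n * (n : ℝ)⁻¹)) (fun _ ↦ v 1 * (√n * (2 * (n : ℝ))⁻¹))
  have hZ : HasGaussianLaw (fun ω i ↦ Z i ω) P := by
    have h1 := ((hX.isGaussianProcess_normIncr hT).comp_right f).hasGaussianLaw Finset.univ
    exact h1.map (ContinuousLinearMap.pi fun i ↦
      ContinuousLinearMap.proj (⟨i, Finset.mem_univ i⟩ : (Finset.univ : Finset (s ⊕ s'))))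
  have hZ0 (i) : ∫ ω, Z i ω ∂P = 0 := hX.integral_normIncr hT (f i).2
  have hsum (ω) : v 0 * (√n * (n : ℝ)⁻¹) * quadVar P T X n ω +
      v 1 * (√n * (2 * (n : ℝ))⁻¹) * quadVar P T X (2 * n) ω = ∑ i, w i * Z i ω ^ 2 := by
    rw [Fintype.sum_sum_type]
    simp only [w, Z, f, Sum.elim_inl, Sum.elim_inr, ← Finset.mul_sum]
    rw [Finset.sum_coe_sort s (fun k ↦ normIncr P T X n k ω ^ 2),
      Finset.sum_coe_sort s' (fun k ↦ normIncr P T X (2 * n) k ω ^ 2)]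
    rfl
  have hW (i) : |w i| ≤ (|v 0| + |v 1|) * (√n * (n : ℝ)⁻¹) := by
    have hr : (0 : ℝ) ≤ √n * (n : ℝ)⁻¹ := by positivity
    rcases i with i | i
    · simp only [w, Sum.elim_inl]
      rw [abs_mul, abs_of_nonneg hr]
      exact mul_le_mul_of_nonneg_right (le_add_of_nonneg_right (abs_nonneg _)) hr
    · have hr' : √n * (2 * (n : ℝ))⁻¹ = 2⁻¹ * (√n * (n : ℝ)⁻¹) := by
        rw [mul_inv]; ring
      simp only [w, Sum.elim_inr]
      rw [hr', abs_mul, abs_of_nonneg (by positivity : 0 ≤ 2⁻¹ * (√n * (n : ℝ)⁻¹))]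
      nlinarith [mul_nonneg (abs_nonneg (v 0)) hr, mul_nonneg (abs_nonneg (v 1)) hr]
  -- By `(a + b)² ≤ 2a² + 2b²`, the row-sum bounds within each mesh suffice, at the cost of a factor
  -- two; correlations between meshes need no bound.
  have hM (u : s ⊕ s' → ℝ) :
      ∫ ω, (∑ i, u i * Z i ω) ^ 2 ∂P ≤ 2 * C * ∑ i, u i ^ 2 := by
    set u1 : ℕ → ℝ := fun k ↦ if hk : k ∈ s then u (.inl ⟨k, hk⟩) else 0
    set u2 : ℕ → ℝ := fun k ↦ if hk : k ∈ s' then u (.inr ⟨k, hk⟩) else 0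
    have e1 (k : s) : u (.inl k) = u1 k := by simp [u1]
    have e2 (k : s') : u (.inr k) = u2 k := by simp [u2]
    have b1 := hX.integral_sum_normIncr_sq_le hT hC1 u1
    have b2 := hX.integral_sum_normIncr_sq_le hT hC2 u2
    have i1 : Integrable (fun ω ↦ (∑ k ∈ s, u1 k * normIncr P T X n k ω) ^ 2) P :=
      (memLp_finsetSum s fun k hk ↦
        (hX.hasGaussianLaw_normIncr hT hk).memLp_two.const_mul (u1 k)).integrable_sq
    have i2 : Integrable (fun ω ↦ (∑ k ∈ s', u2 k * normIncr P T X (2 * n) k ω) ^ 2) P :=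
      (memLp_finsetSum s' fun k hk ↦
        (hX.hasGaussianLaw_normIncr hT hk).memLp_two.const_mul (u2 k)).integrable_sq
    have i0 : Integrable (fun ω ↦ (∑ i, u i * Z i ω) ^ 2) P :=
      (memLp_finsetSum _ fun i _ ↦ (hZ.eval i).memLp_two.const_mul (u i)).integrable_sq
    calc ∫ ω, (∑ i, u i * Z i ω) ^ 2 ∂P
        ≤ ∫ ω, (2 * (∑ k ∈ s, u1 k * normIncr P T X n k ω) ^ 2 +
          2 * (∑ k ∈ s', u2 k * normIncr P T X (2 * n) k ω) ^ 2) ∂P := by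
          refine integral_mono i0 ((i1.const_mul 2).add (i2.const_mul 2)) fun ω ↦ ?_
          simp only [Fintype.sum_sum_type, e1, e2, Z, f, Sum.elim_inl, Sum.elim_inr]
          rw [Finset.sum_coe_sort s (fun k ↦ u1 k * normIncr P T X n k ω),
            Finset.sum_coe_sort s' (fun k ↦ u2 k * normIncr P T X (2 * n) k ω)]
          nlinarith [sq_nonneg (∑ k ∈ s, u1 k * normIncr P T X n k ω -
            ∑ k ∈ s', u2 k * normIncr P T X (2 * n) k ω)]
      _ ≤ 2 * (C * ∑ k ∈ s, u1 k ^ 2) + 2 * (C * ∑ k ∈ s', u2 k ^ 2) := by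
          rw [integral_add (i1.const_mul 2) (i2.const_mul 2), integral_const_mul,
            integral_const_mul]
          linarith
      _ = 2 * C * ∑ i, u i ^ 2 := by
          simp only [Fintype.sum_sum_type, e1, e2]
          rw [Finset.sum_coe_sort s (fun k ↦ u1 k ^ 2), Finset.sum_coe_sort s' (fun k ↦ u2 k ^ 2)]
          ring
  have key := norm_integral_exp_quadraticForm_sub_le h hZ hZ0 w hW hM hδ
  simp only [← hsum] at key
  rw [charFun_apply, integral_map (hX.aemeasurable_centredPair hT n) (by fun_prop)]
  simpa only [hX.inner_centredPair hT] using key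

end Limits

end QuadVar

/-! ### Convergence in distribution. -/

theorem corollaryc
    {Ω Ω' : Type*} [MeasurableSpace Ω] [MeasurableSpace Ω']
    (P : Measure Ω) [IsProbabilityMeasure P] (P' : Measure Ω') [IsProbabilityMeasure P']
    (T : ℝ) (hT : 0 < T) (X : ℝ → Ω → ℝ)
    (hX : QuadVar.IsCenteredGaussianOn P T X)
    (hX0 : ∀ᵐ ω ∂P, X 0 ω = 0)
    (hrow : ∃ C : ℝ, ∀ n : ℕ, 1 ≤ n → ∀ i ∈ ({1, 2} : Finset ℕ),
      ∀ k ∈ Finset.Icc 1 (i * n - 1),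
        ∑ j ∈ Finset.Icc 1 (i * n - 1), |QuadVar.incrCov P T X (i * n) j k| ≤ C)
    (γ : ℝ) (B : ℝ → Ω' → ℝ) (hB : QuadVar.IsFractionalBrownianMotion P' T γ B)
    (hcov : ∀ i ∈ ({1, 2} : Finset ℕ), ∀ j ∈ ({1, 2} : Finset ℕ),
      Tendsto (fun n : ℕ => (1 / (n : ℝ)) *
        (cov[fun ω => (i : ℝ)⁻¹ * QuadVar.quadVar P T X (i * n) ω,
            fun ω => (j : ℝ)⁻¹ * QuadVar.quadVar P T X (j * n) ω; P]
          - cov[fun ω => (i : ℝ)⁻¹ * QuadVar.quadVar P' T B (i * n) ω,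
            fun ω => (j : ℝ)⁻¹ * QuadVar.quadVar P' T B (j * n) ω; P']))
        atTop (𝓝 0)) :
    Summable (fun j : ℕ => (QuadVar.rhoHat γ ((j : ℤ) + 1)) ^ 2) ∧
    Summable (fun j : ℤ => (QuadVar.rhoTilde γ j) ^ 2) ∧
    (QuadVar.sigmaFBM γ).PosSemidef ∧
    TendstoInDistribution (fun n : ℕ => QuadVar.centredPair P T X n) atTop
      (id : EuclideanSpace ℝ (Fin 2) → EuclideanSpace ℝ (Fin 2))
      (fun _ => P) (multivariateGaussian 0 (QuadVar.sigmaFBM γ)) := by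
  have hpsd := hB.posSemidef_sigmaFBM hT
  refine ⟨QuadVar.summable_rhoHat_succ_sq hB.hurst_pos hB.hurst_lt_one,
    QuadVar.summable_rhoTilde_sq hB.hurst_pos hB.hurst_lt_one, hpsd,
    fun n ↦ hX.aemeasurable_centredPair hT n, aemeasurable_id, ?_⟩
  have hlim (i j : ℕ) (hi : i ∈ ({1, 2} : Finset ℕ)) (hj : j ∈ ({1, 2} : Finset ℕ)) {L : ℝ}
      (hL : Tendsto (QuadVar.scaledCov P' T B i j) atTop (𝓝 L)) :
      Tendsto (QuadVar.scaledCov P T X i j) atTop (𝓝 L) := by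
    have h := (hcov i hi j hj).add hL
    rw [zero_add] at h
    refine h.congr fun n ↦ ?_
    simp only [QuadVar.scaledCov]
    ring
  have hvar := hX.tendsto_variance hT
    (hlim 1 1 (by simp) (by simp) (hB.tendsto_scaledCov_one_one hT))
    (hlim 1 2 (by simp) (by simp) (hB.tendsto_scaledCov_one_two hT))
    (hlim 2 2 (by simp) (by simp) (hB.tendsto_scaledCov_two_two hT))
  obtain ⟨C, hC⟩ := hrow
  refine ProbabilityMeasure.tendsto_iff_tendsto_charFun.2 fun v ↦ ?_
  have hvar := hvar v
  simp only [ProbabilityMeasure.coe_mk, Measure.map_id]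
  set V : ℕ → ℝ := fun n ↦ Var[fun ω ↦ v 0 * (√n * (n : ℝ)⁻¹) * QuadVar.quadVar P T X n ω +
        v 1 * (√n * (2 * (n : ℝ))⁻¹) * QuadVar.quadVar P T X (2 * n) ω; P] with hV
  set q := dotProduct v ((QuadVar.sigmaFBM γ).mulVec v) with hq
  have hlimit : charFun (multivariateGaussian 0 (QuadVar.sigmaFBM γ)) v =
      (Real.exp (-q / 2) : ℂ) := by
    rw [charFun_multivariateGaussian hpsd, inner_zero_right, ← hq]
    push_cast
    congr 1
    ring
  have hexp : Tendsto (fun n ↦ (Real.exp (-V n / 2) : ℂ)) atTop (𝓝 (Real.exp (-q / 2) : ℂ)) :=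
    (Complex.continuous_ofReal.comp (Real.continuous_exp.comp
      (continuous_neg.div_const 2))).continuousAt.tendsto.comp hvar
  -- This product of weight bound and operator bound dominates every eigenvalue `|l_i|`; it is of
  -- order `n^{-1/2}`.
  have hscale : Tendsto (fun n : ℕ ↦ (|v 0| + |v 1|) * (√n * (n : ℝ)⁻¹) * (2 * C)) atTop (𝓝 0) := by
    have h1 : Tendsto (fun n : ℕ ↦ (√n)⁻¹) atTop (𝓝 0) :=
      tendsto_inv_atTop_zero.comp (Real.tendsto_sqrt_atTop.comp tendsto_natCast_atTop_atTop)
    have h2 := (h1.const_mul (|v 0| + |v 1|)).mul_const (2 * C)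
    rw [mul_zero, zero_mul] at h2
    refine h2.congr fun n ↦ ?_
    rw [← div_eq_mul_inv (√(n : ℝ)), Real.sqrt_div_self', one_div]
  have hdiff : Tendsto (fun n ↦ charFun (P.map (QuadVar.centredPair P T X n)) v -
      (Real.exp (-V n / 2) : ℂ)) atTop (𝓝 0) := by
    have hq0 : 0 ≤ q := ge_of_tendsto' hvar fun n ↦ variance_nonneg _ _
    refine Metric.tendsto_nhds.2 fun ε hε ↦ ?_
    -- The error is the chosen tolerance times `V n / 2`, which is eventually below `q / 2 + 1`;
    -- adding one keeps the divisor positive when `q = 0`.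
    obtain ⟨δ, hδ, h⟩ := QuadVar.exists_norm_integral_exp_sq_sub_one_le
      (ε := ε / (q / 2 + 1)) (by positivity)
    filter_upwards [hscale.eventually (eventually_le_nhds hδ), eventually_ge_atTop 1,
      (hvar.div_const 2).eventually (eventually_lt_nhds (lt_add_one (q / 2)))] with n hn hn1 hVn
    rw [dist_zero_right]
    refine (hX.norm_charFun_centredPair_sub_le hT h (by simpa using hC n hn1 1 (by simp))
      (hC n hn1 2 (by simp)) v hn).trans_lt ?_
    calc ε / (q / 2 + 1) * (V n / 2) < ε / (q / 2 + 1) * (q / 2 + 1) := by gcongr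
      _ = ε := div_mul_cancel₀ _ (by positivity)
  have := hdiff.add hexp
  simp only [sub_add_cancel, zero_add] at this
  rw [hlimit]
  exact this
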